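/- \textbf{Conventions.} A (concrete) operator space is a closed subspace $X\subset B(H)$, $H$ a complex Hilbert space, with the norms of $M_n(X)\subset B(\ell_2^n\otimes_2 H)$; "subspace" means closed subspace, and $\overline{\mathrm{span}}$ is the closed linear span. For a linear map $u$ between operator spaces, $\|u\|_{cb}=\sup_n\|I_{M_n}\otimes u\|$. Let $\mathbf R,\mathbf C\subset B(\ell_2)$ be the row and column spaces, i.e. the closed linear spans of the matrix units $(E_{1j})_j$ and $(E_{i1})_i$. For a contraction $A\in B(\ell_2)$ let $X(A)=\{\xi\oplus A\xi:\xi\in\ell_2\}\subset\mathbf R\oplus\mathbf C\subset B(\ell_2\oplus_2\ell_2)$, where in the first summand $\xi$ stands for $\sum_j\xi_jE_{1j}$ and in the second $A\xi$ stands for $\sum_i(A\xi)_iE_{i1}$. For a sequence $\alpha=(\alpha_i)_{i\in\mathbb N}$ in $[0,1]$ put $X^d(\alpha)=X(\mathrm{diag}(\alpha))$; its canonical basis is $e_i=\xi_i\oplus\alpha_i\xi_i$, where $(\xi_i)$ is the canonical basis of $\ell_2$. Let $\mathcal S$ be the set of all non-increasing sequences in $[0,1]$ which converge to $0$. A subspace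 $Y$ of $X(A)$ is identified with a subspace $Y'$ of $\ell_2$ via $\xi\leftrightarrow\xi\oplus A\xi$. A canonical basis of $Y$ is a family $f_i=\eta_i\oplus A\eta_i$ $(i\in I)$, where $(\eta_i)_{i\in I}$ is an orthonormal basis of $Y'$ consisting of eigenvectors of $|A|_{Y'}|=((A|_{Y'})^*A|_{Y'})^{1/2}$; the corresponding eigenvalues $s_i$ are the singular values of $A|_{Y'}$. For $c\ge1$, a family $(x_i)_{i\in I}$ in $X$ is a $c$-completely unconditional basic sequence if $\|\sum_i\lambda_ia_i\otimes x_i\|_{M_n(X)}\le c\,\|\sum_ia_i\otimes x_i\|_{M_n(X)}$ for all $n$, all finite families $(a_i)$ in $M_n$ and all scalars $|\lambda_i|\le1$; it is a $c$-completely unconditional basis of $X$ if moreover $X=\overline{\mathrm{span}}[x_i]$. Families $(x_i)_{i\in I}$ and $(y_i)_{i\in I}$ are $c$-equivalent if there is an isomorphism $u:\overline{\mathrm{span}}[x_i]\to\overline{\mathrm{span}}[y_i]$ with $ux_i=y_i$ for all $i$ and $\|u\|_{cb}\|u^{-1}\|_{cb}\le c$. \textbf{Theorem.} For every $a>1$ there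 is $\alpha\in\mathcal S\setminus\ell_2$ such that the following hold. (1) Every subspace $Y$ of $X^d(\alpha)$, of finite or infinite dimension, has a canonical basis. Every canonical basis $(f_i)_{i\in I}$ of $Y$ is a $1$-completely unconditional basis of $Y$, and it is $a$-equivalent to a subsequence of the canonical basis of $X^d(\alpha)$: there is an injection $\pi:I\to\mathbb N$ such that $(f_i)_{i\in I}$ is $a$-equivalent to $(e_{\pi(i)})_{i\in I}$. If $I$ is linearly ordered so that the singular values $s_i$ are non-increasing in $i$, then $\pi$ can be chosen strictly increasing. (2) Consequently, there are constants $K>0$ and $B\in\{1,2,\dots\}$ such that, for every $C\ge1$, every normalized $C$-completely unconditional basic sequence $(g_i)_{i\in I}$ ($I$ finite or countable) in $X^d(\alpha)$ is $KC^B$-equivalent, up to a permutation, to a subsequence of the canonical basis: there is an injection $\pi:I\to\mathbb N$ such that $(g_i)_{i\in I}$ is $KC^B$-equivalent to $(e_{\pi(i)})_{i\in I}$. -/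

import Mathlib

open scoped ENNReal InnerProductSpace

noncomputable section

namespace OpSpace

/-! ## Concrete operator spaces

A concrete operator space is a (closed) linear subspace of `B(E)`, `E` a complex Hilbert space. -/

section General

variable {E E' : Type*} [NormedAddCommGroup E] [InnerProductSpace ℂ E]
  [NormedAddCommGroup E'] [InnerProductSpace ℂ E']

/-- The operator on the `n`-fold Hilbert sum `E ⊕₂ ⋯ ⊕₂ E = ℓ₂ⁿ ⊗₂ E` given by an `n × n` matrix of
operators on `E`, i.e. `(v_j)_j ↦ (∑ j, x_{ij} v_j)_i`. -/
def matOp {n : ℕ} (x : Matrix (Fin n) (Fin n) (E →L[ℂ] E)) :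
    PiLp 2 (fun _ : Fin n => E) →L[ℂ] PiLp 2 (fun _ : Fin n => E) :=
  ((PiLp.continuousLinearEquiv 2 ℂ (fun _ : Fin n => E)).symm :
      (Fin n → E) →L[ℂ] PiLp 2 (fun _ : Fin n => E)) ∘L
    ContinuousLinearMap.pi
      (fun i => ∑ j, x i j ∘L PiLp.proj (𝕜 := ℂ) 2 (fun _ : Fin n => E) j)

theorem matOp_apply {n : ℕ} (x : Matrix (Fin n) (Fin n) (E →L[ℂ] E))
    (v : PiLp 2 (fun _ : Fin n => E)) (i : Fin n) :
    matOp x v i = ∑ j, x i j (v j) := by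
  simp [matOp]

/-- The matricial norm `‖·‖_n` on `M_n(B(E)) = B(ℓ₂ⁿ ⊗₂ E)`; its restriction to `M_n(X)` is the
matricial norm of an operator space `X ⊆ B(E)`. -/
def matNorm {n : ℕ} (x : Matrix (Fin n) (Fin n) (E →L[ℂ] E)) : ℝ := ‖matOp x‖

/-- The completely bounded norm `sup_n ‖I_{M_n} ⊗ u : M_n(X) → M_n(Y)‖` of a bounded linear map
between operator spaces `X ⊆ B(E)` and `Y ⊆ B(E')` (with value `∞` if `u` is not c.b.). -/
def cbNorm {X : Submodule ℂ (E →L[ℂ] E)} {Y : Submodule ℂ (E' →L[ℂ] E')}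
    (u : X →L[ℂ] Y) : ℝ≥0∞ :=
  ⨆ (n : ℕ) (x : Matrix (Fin n) (Fin n) X)
    (_ : matNorm (x.map (fun z => (z : E →L[ℂ] E))) ≤ 1),
    ENNReal.ofReal (matNorm (x.map (fun z => (u z : E' →L[ℂ] E'))))

/-- The finite sum `∑_{i ∈ s} a_i ⊗ x_i ∈ M_n(B(E))`. -/
def tensorSum {ι : Type*} {n : ℕ} (s : Finset ι) (a : ι → Matrix (Fin n) (Fin n) ℂ)
    (x : ι → (E →L[ℂ] E)) : Matrix (Fin n) (Fin n) (E →L[ℂ] E) :=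
  Matrix.of fun p q => ∑ i ∈ s, a i p q • x i

/-- The closed linear span of a family. -/
def closedSpan {ι : Type*} (x : ι → (E →L[ℂ] E)) : Submodule ℂ (E →L[ℂ] E) :=
  (Submodule.span ℂ (Set.range x)).topologicalClosure

theorem mem_closedSpan {ι : Type*} (x : ι → (E →L[ℂ] E)) (i : ι) : x i ∈ closedSpan x :=
  Submodule.le_topologicalClosure _ (Submodule.subset_span ⟨i, rfl⟩)

/-- `c`-completely unconditional basic sequences (families). -/
def IsCompletelyUnconditional {ι : Type*} (c : ℝ) (x : ι → (E →L[ℂ] E)) : Prop :=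
  1 ≤ c ∧ ∀ (n : ℕ) (s : Finset ι) (a : ι → Matrix (Fin n) (Fin n) ℂ) (l : ι → ℂ),
    (∀ i, ‖l i‖ ≤ 1) →
      matNorm (tensorSum s (fun i => l i • a i) x) ≤ c * matNorm (tensorSum s a x)

/-- `c`-completely unconditional bases of an operator space `Y`. -/
def IsCompletelyUnconditionalBasis {ι : Type*} (c : ℝ) (Y : Submodule ℂ (E →L[ℂ] E))
    (x : ι → (E →L[ℂ] E)) : Prop :=
  IsCompletelyUnconditional c x ∧ Y = closedSpan x

/-- Two families `x`, `y` with the same index set are `c`-equivalent: there is an isomorphism `u` of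
their closed linear spans with `u x_i = y_i` and `‖u‖_cb ‖u⁻¹‖_cb ≤ c`. -/
def AreEquivalent {ι : Type*} (c : ℝ) (x : ι → (E →L[ℂ] E)) (y : ι → (E' →L[ℂ] E')) : Prop :=
  ∃ u : closedSpan x ≃L[ℂ] closedSpan y,
    (∀ i, (u ⟨x i, mem_closedSpan x i⟩ : E' →L[ℂ] E') = y i) ∧
    cbNorm (u : closedSpan x →L[ℂ] closedSpan y) *
      cbNorm (u.symm : closedSpan y →L[ℂ] closedSpan x) ≤ ENNReal.ofReal c

end General

/-! ## The spaces `X(A)` and `X^d(α)` -/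

/-- The complex Hilbert space `ℓ₂`. -/
abbrev EllTwo : Type := lp (fun _ : ℕ => ℂ) 2

/-- The canonical orthonormal basis of `ℓ₂`. -/
def stdBasis (i : ℕ) : EllTwo := lp.single 2 i (1 : ℂ)

/-- The element `∑_j ξ_j E_{1j}` of the row space, i.e. the operator
`ζ ↦ (∑_j ξ_j ζ_j) e_1` on `ℓ₂` (indices start at `0` here). -/
def rowOp (ξ : EllTwo) : EllTwo →L[ℂ] EllTwo :=
  InnerProductSpace.rankOne ℂ (stdBasis 0) (star ξ)

/-- The element `∑_i η_i E_{i1}` of the column space, i.e. the operator `ζ ↦ ζ_1 η` on `ℓ₂`. -/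
def colOp (η : EllTwo) : EllTwo →L[ℂ] EllTwo :=
  InnerProductSpace.rankOne ℂ η (stdBasis 0)

/-- The Hilbert space `ℓ₂ ⊕₂ ℓ₂`. -/
abbrev EllTwoSum : Type := WithLp 2 (EllTwo × EllTwo)

/-- The block diagonal operator `S ⊕ T` on `ℓ₂ ⊕₂ ℓ₂`. -/
def blockDiag (S T : EllTwo →L[ℂ] EllTwo) : EllTwoSum →L[ℂ] EllTwoSum :=
  ((WithLp.prodContinuousLinearEquiv 2 ℂ EllTwo EllTwo).symm :
      (EllTwo × EllTwo) →L[ℂ] EllTwoSum) ∘L (S.prodMap T) ∘L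
    ((WithLp.prodContinuousLinearEquiv 2 ℂ EllTwo EllTwo) :
      EllTwoSum →L[ℂ] (EllTwo × EllTwo))

theorem blockDiag_apply (S T : EllTwo →L[ℂ] EllTwo) (v : EllTwoSum) :
    blockDiag S T v = WithLp.toLp 2 (S v.fst, T v.snd) := rfl

/-- The formal identity `ℓ₂ → X(A)`, `ξ ↦ ξ ⊕ Aξ ∈ R ⊕ C ⊆ B(ℓ₂ ⊕₂ ℓ₂)`. -/
def toX (A : EllTwo →L[ℂ] EllTwo) : EllTwo →ₗ[ℂ] (EllTwoSum →L[ℂ] EllTwoSum) where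
  toFun ξ := blockDiag (rowOp ξ) (colOp (A ξ))
  map_add' ξ η := by
    ext1 v
    simp [blockDiag_apply, rowOp, colOp, ← WithLp.toLp_add]
  map_smul' c ξ := by
    ext1 v
    simp [blockDiag_apply, rowOp, colOp, ← WithLp.toLp_smul]

/-- The operator space `X(A) ⊆ R ⊕ C`, consisting of all `ξ ⊕ Aξ`, `ξ ∈ ℓ₂`. -/
def XSpace (A : EllTwo →L[ℂ] EllTwo) : Submodule ℂ (EllTwoSum →L[ℂ] EllTwoSum) :=
  LinearMap.range (toX A)

theorem norm_diag_le (α : ℕ → unitInterval) (ξ : EllTwo) (i : ℕ) :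
    ‖((α i : ℝ) : ℂ) * ξ i‖ ≤ ‖ξ i‖ := by
  rw [norm_mul, Complex.norm_real, Real.norm_of_nonneg (α i).2.1]
  exact mul_le_of_le_one_left (norm_nonneg _) (α i).2.2

/-- The diagonal contraction `diag(α) : (ξ_i) ↦ (α_i ξ_i)` on `ℓ₂`, for a sequence `α` of numbers
in `[0,1]`. -/
def diag (α : ℕ → unitInterval) : EllTwo →L[ℂ] EllTwo :=
  LinearMap.mkContinuous
    { toFun := fun ξ =>
        ⟨fun i => ((α i : ℝ) : ℂ) * ξ i, (lp.memℓp ξ).mono' (norm_diag_le α ξ)⟩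
      map_add' := fun ξ η => by
        apply lp.ext
        funext i
        exact mul_add _ _ _
      map_smul' := fun c ξ => by
        apply lp.ext
        funext i
        exact mul_left_comm _ _ _ }
    1 (fun ξ => by
      rw [one_mul]
      exact lp.norm_mono two_ne_zero (norm_diag_le α ξ))

theorem diag_apply (α : ℕ → unitInterval) (ξ : EllTwo) (i : ℕ) :
    diag α ξ i = ((α i : ℝ) : ℂ) * ξ i := rfl

/-- `X^d(α) = X(diag(α))`. -/
def XdSpace (α : ℕ → unitInterval) : Submodule ℂ (EllTwoSum →L[ℂ] EllTwoSum) :=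
  XSpace (diag α)

/-- The canonical basis `e_i(α) = ξ_i ⊕ α_i ξ_i` of `X^d(α)`, where `(ξ_i)` is the canonical basis
of `ℓ₂`. -/
def canonicalBasis (α : ℕ → unitInterval) (i : ℕ) : EllTwoSum →L[ℂ] EllTwoSum :=
  toX (diag α) (stdBasis i)

/-- The set `𝒮` of all non-increasing sequences in `[0,1]` which converge to `0`. -/
def SeqS : Set (ℕ → unitInterval) :=
  {α | Antitone α ∧ Filter.Tendsto α Filter.atTop (nhds 0)}

/-! ## Canonical bases of subspaces -/

/-- `(ξ_i)` is an orthonormal basis of `F` which consists of eigenvectors of `|T| = (T* T)^{1/2}`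
(this includes an orthonormal basis of `ker T`), with eigenvalues `(s_i)`. -/
def IsSingularBasis {F G : Type*} [NormedAddCommGroup F] [InnerProductSpace ℂ F] [CompleteSpace F]
    [NormedAddCommGroup G] [InnerProductSpace ℂ G] [CompleteSpace G] (T : F →L[ℂ] G)
    {ι : Type*} (s : ι → ℝ) (ξ : ι → F) : Prop :=
  Orthonormal ℂ ξ ∧ (Submodule.span ℂ (Set.range ξ)).topologicalClosure = ⊤ ∧
    ∀ i, 0 ≤ s i ∧
      ContinuousLinearMap.adjoint T (T (ξ i)) = ((s i : ℂ) ^ 2) • ξ i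

/-- The subspace of `ℓ₂` which corresponds to `Y ⊆ X(A)` under the identification
`ξ ↔ ξ ⊕ Aξ`. -/
def pullback (A : EllTwo →L[ℂ] EllTwo) (Y : Submodule ℂ (EllTwoSum →L[ℂ] EllTwoSum)) :
    Submodule ℂ EllTwo :=
  Y.comap (toX A)

/-- `f = (f_i)_{i ∈ ι}` is a canonical basis of the closed subspace `Y` of `X(A)`, with singular
values `s_i`: identifying `Y` with a subspace `Y'` of `ℓ₂`, so that `Y = X(A|_{Y'})`, one has
`f_i = ξ_i ⊕ A ξ_i` for an orthonormal basis `(ξ_i)` of `Y'` which consists of eigenvectors of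
`|A|_{Y'}|`, with eigenvalues `s_i`. (Completeness of `Y'` amounts to `Y` being closed.) -/
def IsCanonicalBasis (A : EllTwo →L[ℂ] EllTwo) (Y : Submodule ℂ (EllTwoSum →L[ℂ] EllTwoSum))
    {ι : Type*} (s : ι → ℝ) (f : ι → (EllTwoSum →L[ℂ] EllTwoSum)) : Prop :=
  ∃ (_ : CompleteSpace (pullback A Y)) (ξ : ι → pullback A Y),
    IsSingularBasis (A ∘L (pullback A Y).subtypeL) s ξ ∧ ∀ i, f i = toX A (ξ i)

end OpSpace

end

open OpSpace

/-! The norm of a matrix over `X(A)` is the maximum of a row norm, which sees only the vectors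
`ξ_i`, and a column norm, which sees only the `A ξ_i`. If the `ξ_i` are orthonormal and the `A ξ_i`
orthogonal, only the weights `t_i = ‖A ξ_i‖` matter, and comparable weights give equivalent families
(`IsDiagonalFamily.areEquivalent`). Both claims thus become a counting problem: how many weights
exceed a given threshold.

The sequence is constant, equal to `r ^ k` with `r = 1/a`, on blocks of length `b ^ k * (b - 1)`,
where `b * r² ≥ 2`. This growth keeps `α` out of `ℓ₂` and still leaves enough places in each block
(`exists_orderEmbedding_blockSeq`).

For (1), a canonical basis is such a diagonal family. A dimension argument allows at most `b ^
(k+1)` singular values above `r ^ (k+1)`; those in `(r ^ (k+1), r ^ k]` fit into block `k+1`, at the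
cost of one factor `1/r = a`.

For (2), averaging over signs shows that the norm dominates its diagonal version up to `C`.
Conversely, the column Gram form exceeds `C²` times its diagonal by a form whose positive part has
trace at most `C⁴` (`exists_norm_sq_map_sum_le`), and a trace class column form is controlled by the
row norm. So the family behaves like its weights. A Hilbert–Schmidt estimate bounds the number of
weights above `r ^ (k+1)` by a constant times `C² b ^ (k+1)`. The factor `C²` is absorbed by moving
about `log_b C²` blocks further, which costs only a factor of order `C`. -/

namespace OpSpace

/-! ### Matricial norms and reduction of equivalence to finite sums. -/

section General

variable {E E' : Type*} [NormedAddCommGroup E] [InnerProductSpace ℂ E]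
  [NormedAddCommGroup E'] [InnerProductSpace ℂ E']

theorem matOp_eq_sum {n : ℕ} (x : Matrix (Fin n) (Fin n) (E →L[ℂ] E)) :
    matOp x = ∑ p, ∑ q, (((PiLp.continuousLinearEquiv 2 ℂ (fun _ : Fin n => E)).symm :
      (Fin n → E) →L[ℂ] PiLp 2 (fun _ : Fin n => E)) ∘L
        ContinuousLinearMap.single ℂ (fun _ : Fin n => E) p) ∘L
          x p q ∘L PiLp.proj (𝕜 := ℂ) 2 (fun _ : Fin n => E) q := by
  ext v i
  rw [matOp_apply]
  simp only [sum_apply, ContinuousLinearMap.comp_apply, WithLp.ofLp_sum, Finset.sum_apply]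
  symm
  rw [Finset.sum_eq_single i]
  · simp
  · intro p _ hp
    refine Finset.sum_eq_zero fun q _ => ?_
    simp [hp.symm]
  · simp

set_option synthInstance.maxHeartbeats 200000 in
theorem continuous_matOp {n : ℕ} :
    Continuous (matOp : Matrix (Fin n) (Fin n) (E →L[ℂ] E) → _) := by
  simp_rw [funext matOp_eq_sum]
  refine continuous_finsetSum _ fun p _ => continuous_finsetSum _ fun q _ => ?_
  exact continuous_const.clm_comp ((continuous_apply_apply p q).clm_comp continuous_const)

theorem continuous_matNorm {n : ℕ} :
    Continuous (matNorm : Matrix (Fin n) (Fin n) (E →L[ℂ] E) → ℝ) :=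
  (continuous_norm (E := PiLp 2 (fun _ : Fin n => E) →L[ℂ] PiLp 2 (fun _ : Fin n => E))).comp
    continuous_matOp

theorem matNorm_nonneg {n : ℕ} (x : Matrix (Fin n) (Fin n) (E →L[ℂ] E)) : 0 ≤ matNorm x :=
  norm_nonneg (matOp x)

theorem matNorm_le_iff {n : ℕ} (x : Matrix (Fin n) (Fin n) (E →L[ℂ] E)) {c : ℝ} (hc : 0 ≤ c) :
    matNorm x ≤ c ↔ ∀ v : Fin n → E, ∑ p, ‖∑ q, x p q (v q)‖ ^ 2 ≤ c ^ 2 * ∑ q, ‖v q‖ ^ 2 := by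
  rw [matNorm, ContinuousLinearMap.opNorm_le_iff hc]
  refine (WithLp.equiv 2 (Fin n → E)).forall_congr fun v => ?_
  rw [← sq_le_sq₀ (norm_nonneg _) (by positivity), mul_pow, PiLp.norm_sq_eq_of_L2,
    PiLp.norm_sq_eq_of_L2]
  simp_rw [matOp_apply]
  rfl

theorem matNorm_fin_one (x : Matrix (Fin 1) (Fin 1) (E →L[ℂ] E)) : matNorm x = ‖x 0 0‖ := by
  refine le_antisymm ((matNorm_le_iff x (norm_nonneg _)).2 fun v => ?_) ?_
  · simp only [Fin.sum_univ_one, ← mul_pow]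
    gcongr
    exact (x 0 0).le_opNorm _
  · refine ContinuousLinearMap.opNorm_le_bound _ (matNorm_nonneg _) fun w => ?_
    have := (matNorm_le_iff x (matNorm_nonneg x)).1 le_rfl (fun _ => w)
    simp only [Fin.sum_univ_one, ← mul_pow] at this
    exact (sq_le_sq₀ (norm_nonneg _) (mul_nonneg (matNorm_nonneg _) (norm_nonneg _))).1 this

/-- The algebraic span of a family, parametrised by finitely supported coefficients. -/
noncomputable def finsuppToSpan {ι : Type*} (x : ι → (E →L[ℂ] E)) :
    (ι →₀ ℂ) →ₗ[ℂ] closedSpan x :=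
  Finsupp.linearCombination ℂ fun i => ⟨x i, mem_closedSpan x i⟩

theorem coe_finsuppToSpan {ι : Type*} (x : ι → (E →L[ℂ] E)) (d : ι →₀ ℂ) :
    (finsuppToSpan x d : E →L[ℂ] E) = ∑ i ∈ d.support, d i • x i := by
  simp [finsuppToSpan, Finsupp.linearCombination_apply, Finsupp.sum]

theorem denseRange_finsuppToSpan {ι : Type*} (x : ι → (E →L[ℂ] E)) :
    DenseRange (finsuppToSpan x) := by
  rw [DenseRange, Subtype.dense_iff]
  intro z hz
  have : (Submodule.span ℂ (Set.range x) : Set (E →L[ℂ] E)) ⊆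
      Subtype.val '' Set.range (finsuppToSpan x) := by
    intro w hw
    obtain ⟨d, rfl⟩ := (Finsupp.mem_span_range_iff_exists_finsupp).1 hw
    exact ⟨_, ⟨d, rfl⟩, coe_finsuppToSpan x d⟩
  exact closure_mono this hz

theorem map_finsuppToSpan_eq_tensorSum {ι : Type*} {n : ℕ} (x : ι → (E →L[ℂ] E))
    (d : Matrix (Fin n) (Fin n) (ι →₀ ℂ)) (s : Finset ι) (hs : ∀ p q, (d p q).support ⊆ s) :
    d.map (fun z => (finsuppToSpan x z : E →L[ℂ] E)) =
      tensorSum s (fun i => Matrix.of fun p q => d p q i) x := by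
  ext1 p q
  simp only [Matrix.map_apply, coe_finsuppToSpan, tensorSum, Matrix.of_apply]
  refine Finset.sum_subset (hs p q) fun i _ hi => ?_
  simp [Finsupp.notMem_support_iff.1 hi]

theorem matNorm_map_finsuppToSpan_le {ι : Type*} {x : ι → (E →L[ℂ] E)} {y : ι → (E' →L[ℂ] E')}
    {c : ℝ} (h : ∀ (n : ℕ) (s : Finset ι) (a : ι → Matrix (Fin n) (Fin n) ℂ),
      matNorm (tensorSum s a y) ≤ c * matNorm (tensorSum s a x))
    {n : ℕ} (d : Matrix (Fin n) (Fin n) (ι →₀ ℂ)) :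
    matNorm (d.map (fun z => (finsuppToSpan y z : E' →L[ℂ] E'))) ≤
      c * matNorm (d.map (fun z => (finsuppToSpan x z : E →L[ℂ] E))) := by
  classical
  have hs : ∀ p q, (d p q).support ⊆
      Finset.univ.biUnion fun p => Finset.univ.biUnion fun q => (d p q).support := by
    intro p q i hi
    simp only [Finset.mem_biUnion, Finset.mem_univ, true_and]
    exact ⟨p, q, hi⟩
  rw [map_finsuppToSpan_eq_tensorSum x d _ hs, map_finsuppToSpan_eq_tensorSum y d _ hs]
  exact h _ _ _

theorem norm_finsuppToSpan_le {ι : Type*} {x : ι → (E →L[ℂ] E)} {y : ι → (E' →L[ℂ] E')}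
    {c : ℝ} (h : ∀ (n : ℕ) (s : Finset ι) (a : ι → Matrix (Fin n) (Fin n) ℂ),
      matNorm (tensorSum s a y) ≤ c * matNorm (tensorSum s a x)) (d : ι →₀ ℂ) :
    ‖finsuppToSpan y d‖ ≤ c * ‖finsuppToSpan x d‖ := by
  simpa [matNorm_fin_one] using
    matNorm_map_finsuppToSpan_le h (Matrix.of fun (_ _ : Fin 1) => d)

theorem cbNorm_le_of_forall_finsupp {ι : Type*} {x : ι → (E →L[ℂ] E)} {y : ι → (E' →L[ℂ] E')}
    {c : ℝ} (hc : 0 ≤ c) (h : ∀ (n : ℕ) (s : Finset ι) (a : ι → Matrix (Fin n) (Fin n) ℂ),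
      matNorm (tensorSum s a y) ≤ c * matNorm (tensorSum s a x))
    (u : closedSpan x →L[ℂ] closedSpan y) (hu : ∀ d, u (finsuppToSpan x d) = finsuppToSpan y d) :
    cbNorm u ≤ ENNReal.ofReal c := by
  refine iSup_le fun n => iSup_le fun z => iSup_le fun hz => ENNReal.ofReal_le_ofReal ?_
  suffices H : ∀ z : Fin n → Fin n → closedSpan x,
      matNorm ((Matrix.of z).map (fun z => (u z : E' →L[ℂ] E'))) ≤
        c * matNorm ((Matrix.of z).map (fun z => (z : E →L[ℂ] E))) from
    (H z).trans (mul_le_of_le_one_right hc hz)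
  -- Matrices over the algebraic span are dense in those over the closed span, and both sides of the
  -- inequality are continuous.
  have hd : DenseRange (Pi.map fun _ : Fin n => Pi.map fun _ : Fin n => finsuppToSpan x) :=
    DenseRange.piMap fun _ => DenseRange.piMap fun _ => denseRange_finsuppToSpan x
  refine fun z => hd.induction_on z ?_ ?_
  · refine isClosed_le (continuous_matNorm.comp ?_)
      (continuous_const.mul (continuous_matNorm.comp ?_))
    · refine continuous_pi fun p => continuous_pi fun q => ?_
      exact continuous_subtype_val.comp (u.continuous.comp (continuous_apply_apply p q))
    · refine continuous_pi fun p => continuous_pi fun q => ?_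
      exact continuous_subtype_val.comp (continuous_apply_apply p q)
  · intro d
    have := matNorm_map_finsuppToSpan_le h (Matrix.of d)
    simp_rw [← hu] at this
    exact this

/-- The case `n = 1` extends the correspondence of finite sums to the closed spans in both
directions; all `n` together bound the two cb-norms. -/
theorem areEquivalent_of_matNorm_le [CompleteSpace E] [CompleteSpace E'] {ι : Type*}
    {x : ι → (E →L[ℂ] E)} {y : ι → (E' →L[ℂ] E')} {c c₁ c₂ : ℝ} (hc₁ : 0 ≤ c₁) (hc₂ : 0 ≤ c₂)
    (hc : c₁ * c₂ ≤ c)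
    (hxy : ∀ (n : ℕ) (s : Finset ι) (a : ι → Matrix (Fin n) (Fin n) ℂ),
      matNorm (tensorSum s a y) ≤ c₁ * matNorm (tensorSum s a x))
    (hyx : ∀ (n : ℕ) (s : Finset ι) (a : ι → Matrix (Fin n) (Fin n) ℂ),
      matNorm (tensorSum s a x) ≤ c₂ * matNorm (tensorSum s a y)) :
    AreEquivalent c x y := by
  have : CompleteSpace (closedSpan x) :=
    (Submodule.isClosed_topologicalClosure _).completeSpace_coe
  have : CompleteSpace (closedSpan y) :=
    (Submodule.isClosed_topologicalClosure _).completeSpace_coe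
  let u : closedSpan x ≃L[ℂ] closedSpan y :=
    (LinearEquiv.refl ℂ (ι →₀ ℂ)).extend (finsuppToSpan x) (finsuppToSpan y)
      (denseRange_finsuppToSpan x) ⟨c₁, norm_finsuppToSpan_le hxy⟩
      (denseRange_finsuppToSpan y) ⟨c₂, norm_finsuppToSpan_le hyx⟩
  have hu (d : ι →₀ ℂ) : u (finsuppToSpan x d) = finsuppToSpan y d :=
    LinearEquiv.extend_eq ..
  have hu' (d : ι →₀ ℂ) : u.symm (finsuppToSpan y d) = finsuppToSpan x d :=
    LinearEquiv.extend_symm_eq ..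
  refine ⟨u, fun i => ?_, ?_⟩
  · have := hu (Finsupp.single i 1)
    simp only [finsuppToSpan, Finsupp.linearCombination_single, one_smul] at this
    rw [this]
  · refine (mul_le_mul' (cbNorm_le_of_forall_finsupp hc₁ hxy _ hu)
      (cbNorm_le_of_forall_finsupp hc₂ hyx _ hu')).trans ?_
    rw [← ENNReal.ofReal_mul hc₁]
    exact ENNReal.ofReal_le_ofReal hc

end General

/-! ### A matrix and its adjoint have the same norm. -/

section Duality

theorem le_sq_mul_sum_sq_of_le_sum_mul {κ : Type*} (s : Finset κ) (u v : κ → ℝ) {S c : ℝ}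
    (hS : 0 ≤ S) (h : S ≤ ∑ k ∈ s, u k * v k) (hu : ∑ k ∈ s, u k ^ 2 ≤ c ^ 2 * S) :
    S ≤ c ^ 2 * ∑ k ∈ s, v k ^ 2 := by
  rcases hS.eq_or_lt with rfl | hS'
  · positivity
  have h1 : S ^ 2 ≤ (c ^ 2 * S) * ∑ k ∈ s, v k ^ 2 :=
    calc S ^ 2 ≤ (∑ k ∈ s, u k * v k) ^ 2 := by gcongr
      _ ≤ (∑ k ∈ s, u k ^ 2) * ∑ k ∈ s, v k ^ 2 := Finset.sum_mul_sq_le_sq_mul_sq ..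
      _ ≤ _ := by gcongr
  have h2 : S * S ≤ S * (c ^ 2 * ∑ k ∈ s, v k ^ 2) := by linarith
  exact le_of_mul_le_mul_left h2 hS'

variable {H : Type*} [NormedAddCommGroup H] [InnerProductSpace ℂ H]

/-- Equality of the norms of a matrix of functionals and its adjoint, each direction obtained by
testing on the image of the other. It replaces test vectors with entries in `H` by scalar ones in
the row part of the norm. -/
theorem sum_norm_sq_inner_le_iff {n : ℕ} (w : Fin n → Fin n → H) (c : ℝ) :
    (∀ f : Fin n → H, ∑ p, ‖∑ q, ⟪w p q, f q⟫_ℂ‖ ^ 2 ≤ c ^ 2 * ∑ q, ‖f q‖ ^ 2) ↔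
      ∀ y : Fin n → ℂ, ∑ q, ‖∑ p, y p • w p q‖ ^ 2 ≤ c ^ 2 * ∑ p, ‖y p‖ ^ 2 := by
  have key (f : Fin n → H) (y : Fin n → ℂ) :
      ∑ q, ⟪∑ p, y p • w p q, f q⟫_ℂ = ∑ p, ⟪y p, ∑ q, ⟪w p q, f q⟫_ℂ⟫_ℂ := by
    simp_rw [sum_inner, inner_sum, inner_smul_left]
    rw [Finset.sum_comm]
    refine Finset.sum_congr rfl fun p _ => Finset.sum_congr rfl fun q _ => ?_
    simp [mul_comm]
  constructor
  · intro h y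
    set f : Fin n → H := fun q => ∑ p, y p • w p q with hf
    refine le_sq_mul_sum_sq_of_le_sum_mul Finset.univ (fun p => ‖∑ q, ⟪w p q, f q⟫_ℂ‖) _
      (by positivity) ?_ (h f)
    have h1 := key f y
    have h2 : ((∑ q, ‖f q‖ ^ 2 : ℝ) : ℂ) = ∑ p, ⟪y p, ∑ q, ⟪w p q, f q⟫_ℂ⟫_ℂ := by
      rw [← h1]
      push_cast
      exact Finset.sum_congr rfl fun q _ => (inner_self_eq_norm_sq_to_K (𝕜 := ℂ) (f q)).symm
    have h3 : ‖((∑ q, ‖f q‖ ^ 2 : ℝ) : ℂ)‖ = ∑ q, ‖f q‖ ^ 2 := by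
      rw [Complex.norm_real, Real.norm_of_nonneg (by positivity)]
    rw [← h3, h2]
    refine (norm_sum_le _ _).trans (Finset.sum_le_sum fun p _ => ?_)
    exact (norm_inner_le_norm _ _).trans_eq (mul_comm _ _)
  · intro h f
    set y : Fin n → ℂ := fun p => ∑ q, ⟪w p q, f q⟫_ℂ with hy
    refine le_sq_mul_sum_sq_of_le_sum_mul Finset.univ (fun q => ‖∑ p, y p • w p q‖) _
      (by positivity) ?_ (h y)
    have h1 := key f y
    have h2 : ((∑ p, ‖y p‖ ^ 2 : ℝ) : ℂ) = ∑ q, ⟪∑ p, y p • w p q, f q⟫_ℂ := by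
      rw [h1]
      push_cast
      exact Finset.sum_congr rfl fun q _ => (inner_self_eq_norm_sq_to_K (𝕜 := ℂ) (y q)).symm
    have h3 : ‖((∑ p, ‖y p‖ ^ 2 : ℝ) : ℂ)‖ = ∑ p, ‖y p‖ ^ 2 := by
      rw [Complex.norm_real, Real.norm_of_nonneg (by positivity)]
    rw [← h3, h2]
    exact (norm_sum_le _ _).trans (Finset.sum_le_sum fun p _ => norm_inner_le_norm _ _)

end Duality

/-! ### The norm of `X(A)` as a row part and a column part. -/

section RowColumn

theorem norm_stdBasis (i : ℕ) : ‖stdBasis i‖ = 1 := by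
  simp [stdBasis]

theorem norm_sq_sum_toX_apply {n : ℕ} (A : EllTwo →L[ℂ] EllTwo) (w : Fin n → EllTwo)
    (v : Fin n → EllTwoSum) :
    ‖∑ q, toX A (w q) (v q)‖ ^ 2 = ‖∑ q, ⟪star (w q), (v q).fst⟫_ℂ‖ ^ 2 +
      ‖A (∑ q, ⟪stdBasis 0, (v q).snd⟫_ℂ • w q)‖ ^ 2 := by
  have h1 : (∑ q, toX A (w q) (v q)).fst =
      (∑ q, ⟪star (w q), (v q).fst⟫_ℂ) • stdBasis 0 := by
    rw [← WithLp.ofLp_fst, WithLp.ofLp_sum, Prod.fst_sum, Finset.sum_smul]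
    rfl
  have h2 : (∑ q, toX A (w q) (v q)).snd = A (∑ q, ⟪stdBasis 0, (v q).snd⟫_ℂ • w q) := by
    rw [← WithLp.ofLp_snd, WithLp.ofLp_sum, Prod.snd_sum, map_sum]
    simp_rw [map_smul]
    rfl
  rw [WithLp.prod_norm_sq_eq_of_L2, h1, h2, norm_smul, norm_stdBasis, mul_one]

/-- The two blocks act on orthogonal summands, so their bounds separate. The column block sees a
test vector only through its component along `stdBasis 0`; the row block is reduced to scalar test
vectors by duality. -/
theorem matNorm_toX_le_iff {n : ℕ} (A : EllTwo →L[ℂ] EllTwo) (w : Fin n → Fin n → EllTwo)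
    {c : ℝ} (hc : 0 ≤ c) :
    matNorm (Matrix.of fun p q => toX A (w p q)) ≤ c ↔
      (∀ y : Fin n → ℂ, ∑ q, ‖∑ p, y p • w p q‖ ^ 2 ≤ c ^ 2 * ∑ p, ‖y p‖ ^ 2) ∧
      (∀ x : Fin n → ℂ, ∑ p, ‖A (∑ q, x q • w p q)‖ ^ 2 ≤ c ^ 2 * ∑ q, ‖x q‖ ^ 2) := by
  have hstar : (∀ y : Fin n → ℂ, ∑ q, ‖∑ p, y p • w p q‖ ^ 2 ≤ c ^ 2 * ∑ p, ‖y p‖ ^ 2) ↔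
      ∀ f : Fin n → EllTwo, ∑ p, ‖∑ q, ⟪star (w p q), f q⟫_ℂ‖ ^ 2 ≤ c ^ 2 * ∑ q, ‖f q‖ ^ 2 := by
    rw [sum_norm_sq_inner_le_iff (fun p q => star (w p q)) c]
    refine (Equiv.ofBijective (star : (Fin n → ℂ) → _) star_involutive.bijective).forall_congr
      fun y => ?_
    have (q : Fin n) : ‖∑ p, star (y p) • star (w p q)‖ = ‖∑ p, y p • w p q‖ := by
      rw [← norm_star (∑ p, y p • w p q), star_sum]
      simp_rw [star_smul]
    simp [← this]
  rw [hstar, matNorm_le_iff _ hc]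
  simp only [Matrix.of_apply, norm_sq_sum_toX_apply, Finset.sum_add_distrib]
  constructor
  · intro h
    refine ⟨fun f => ?_, fun x => ?_⟩
    · simpa [WithLp.prod_norm_sq_eq_of_L2] using h fun q => WithLp.toLp 2 (f q, 0)
    · simpa [WithLp.prod_norm_sq_eq_of_L2, inner_smul_right, norm_smul, norm_stdBasis] using
        h fun q => WithLp.toLp 2 (0, x q • stdBasis 0)
  · rintro ⟨h1, h2⟩ v
    have h1 := h1 fun q => (v q).fst
    have h2 := h2 fun q => ⟪stdBasis 0, (v q).snd⟫_ℂ
    have h3 : ∑ q, ‖⟪stdBasis 0, (v q).snd⟫_ℂ‖ ^ 2 ≤ ∑ q, ‖(v q).snd‖ ^ 2 := by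
      gcongr with q
      simpa [norm_stdBasis] using norm_inner_le_norm (𝕜 := ℂ) (stdBasis 0) (v q).snd
    simp_rw [WithLp.prod_norm_sq_eq_of_L2, Finset.sum_add_distrib, mul_add]
    exact add_le_add h1 (h2.trans (by gcongr))

theorem tensorSum_toX {ι : Type*} {n : ℕ} (A : EllTwo →L[ℂ] EllTwo) (s : Finset ι)
    (a : ι → Matrix (Fin n) (Fin n) ℂ) (ξ : ι → EllTwo) :
    tensorSum s a (fun i => toX A (ξ i)) =
      Matrix.of fun p q => toX A (∑ i ∈ s, a i p q • ξ i) := by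
  ext1 p q
  simp [tensorSum]

open Matrix in
/-- The matricial norms of `X(A)`: the row part and the column part. -/
theorem matNorm_tensorSum_toX_le_iff {ι : Type*} {n : ℕ} (A : EllTwo →L[ℂ] EllTwo) (s : Finset ι)
    (a : ι → Matrix (Fin n) (Fin n) ℂ) (ξ : ι → EllTwo) {c : ℝ} (hc : 0 ≤ c) :
    matNorm (tensorSum s a (fun i => toX A (ξ i))) ≤ c ↔
      (∀ y : Fin n → ℂ, ∑ q, ‖∑ i ∈ s, (y ᵥ* a i) q • ξ i‖ ^ 2 ≤ c ^ 2 * ∑ p, ‖y p‖ ^ 2) ∧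
      (∀ x : Fin n → ℂ, ∑ p, ‖A (∑ i ∈ s, (a i *ᵥ x) p • ξ i)‖ ^ 2 ≤
        c ^ 2 * ∑ q, ‖x q‖ ^ 2) := by
  rw [tensorSum_toX, matNorm_toX_le_iff A _ hc]
  have h1 (y : Fin n → ℂ) (q : Fin n) :
      ∑ p, y p • ∑ i ∈ s, a i p q • ξ i = ∑ i ∈ s, (y ᵥ* a i) q • ξ i := by
    simp_rw [Finset.smul_sum, smul_smul]
    rw [Finset.sum_comm]
    simp_rw [← Finset.sum_smul]
    rfl
  have h2 (x : Fin n → ℂ) (p : Fin n) :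
      ∑ q, x q • ∑ i ∈ s, a i p q • ξ i = ∑ i ∈ s, (a i *ᵥ x) p • ξ i := by
    simp_rw [Finset.smul_sum, smul_smul]
    rw [Finset.sum_comm]
    simp_rw [← Finset.sum_smul, mul_comm (x _)]
    rfl
  simp_rw [h1, h2]

theorem norm_toX_le_iff (A : EllTwo →L[ℂ] EllTwo) (ξ : EllTwo) {c : ℝ} (hc : 0 ≤ c) :
    ‖toX A ξ‖ ≤ c ↔ ‖ξ‖ ≤ c ∧ ‖A ξ‖ ≤ c := by
  have h := matNorm_toX_le_iff A (fun (_ _ : Fin 1) => ξ) hc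
  simp only [matNorm_fin_one, Matrix.of_apply, Fin.sum_univ_one, map_smul, norm_smul,
    mul_pow] at h
  rw [h]
  have key (r : ℝ) (hr : 0 ≤ r) :
      (∀ y : Fin 1 → ℂ, ‖y 0‖ ^ 2 * r ^ 2 ≤ c ^ 2 * ‖y 0‖ ^ 2) ↔ r ≤ c := by
    refine ⟨fun h => ?_, fun h y => ?_⟩
    · have := h 1
      simp only [Pi.one_apply, norm_one, one_pow, one_mul, mul_one] at this
      exact (sq_le_sq₀ hr hc).1 this
    · rw [mul_comm]
      gcongr
  rw [key _ (norm_nonneg _), key _ (norm_nonneg _)]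

theorem norm_toX {A : EllTwo →L[ℂ] EllTwo} (hA : ‖A‖ ≤ 1) (ξ : EllTwo) : ‖toX A ξ‖ = ‖ξ‖ := by
  refine le_antisymm ((norm_toX_le_iff A ξ (norm_nonneg _)).2 ⟨le_rfl, ?_⟩)
    ((norm_toX_le_iff A ξ (norm_nonneg _)).1 le_rfl).1
  exact (A.le_opNorm ξ).trans (mul_le_of_le_one_left (norm_nonneg _) hA)

end RowColumn

/-! ### Diagonal families and their weights. -/

section Weighted

variable {ι : Type*}

open Matrix in
/-- The condition `‖∑ a_i ⊗ x_i‖ ≤ c` for the canonical basis `(x_i)` of `X(diag t)`. -/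
def WeightedBound {n : ℕ} (t : ι → ℝ) (s : Finset ι) (a : ι → Matrix (Fin n) (Fin n) ℂ)
    (c : ℝ) : Prop :=
  (∀ y : Fin n → ℂ, ∑ q, ∑ i ∈ s, ‖(y ᵥ* a i) q‖ ^ 2 ≤ c ^ 2 * ∑ p, ‖y p‖ ^ 2) ∧
  (∀ x : Fin n → ℂ, ∑ p, ∑ i ∈ s, t i ^ 2 * ‖(a i *ᵥ x) p‖ ^ 2 ≤ c ^ 2 * ∑ q, ‖x q‖ ^ 2)

theorem WeightedBound.smul {n : ℕ} {t : ι → ℝ} {s : Finset ι} {a : ι → Matrix (Fin n) (Fin n) ℂ}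
    {c : ℝ} (h : WeightedBound t s a c) {l : ι → ℂ} (hl : ∀ i, ‖l i‖ ≤ 1) :
    WeightedBound t s (fun i => l i • a i) c := by
  refine ⟨fun y => le_trans ?_ (h.1 y), fun x => le_trans ?_ (h.2 x)⟩
  · gcongr with q _ i
    rw [Matrix.vecMul_smul, Pi.smul_apply, norm_smul]
    exact mul_le_of_le_one_left (norm_nonneg _) (hl i)
  · gcongr with q _ i
    rw [Matrix.smul_mulVec, Pi.smul_apply, norm_smul]
    exact mul_le_of_le_one_left (norm_nonneg _) (hl i)

/-- The weights enter the column inequality only; `1 ≤ μ` preserves the row inequality. -/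
theorem WeightedBound.mono_weight {n : ℕ} {t t' : ι → ℝ} {s : Finset ι}
    {a : ι → Matrix (Fin n) (Fin n) ℂ} {c μ : ℝ} (h : WeightedBound t s a c) (hμ : 1 ≤ μ)
    (ht' : ∀ i, 0 ≤ t' i) (htt' : ∀ i, t' i ≤ μ * t i) : WeightedBound t' s a (μ * c) := by
  refine ⟨fun y => (h.1 y).trans ?_, fun x => ?_⟩
  · gcongr ?_ * _
    rw [mul_pow]
    exact le_mul_of_one_le_left (by positivity) (one_le_pow₀ hμ)
  · calc ∑ p, ∑ i ∈ s, t' i ^ 2 * ‖(a i).mulVec x p‖ ^ 2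
        ≤ ∑ p, ∑ i ∈ s, (μ * t i) ^ 2 * ‖(a i).mulVec x p‖ ^ 2 := by
          gcongr with p _ i
          exacts [ht' i, htt' i]
      _ = μ ^ 2 * ∑ p, ∑ i ∈ s, t i ^ 2 * ‖(a i).mulVec x p‖ ^ 2 := by
          simp_rw [Finset.mul_sum, mul_pow, mul_assoc]
      _ ≤ μ ^ 2 * (c ^ 2 * ∑ q, ‖x q‖ ^ 2) := by gcongr; exact h.2 x
      _ = _ := by ring

theorem norm_sq_sum_smul_of_orthogonal {H : Type*} [NormedAddCommGroup H] [InnerProductSpace ℂ H]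
    (s : Finset ι) (d : ι → ℂ) (w : ι → H) (hw : Pairwise fun i j => ⟪w i, w j⟫_ℂ = 0) :
    ‖∑ i ∈ s, d i • w i‖ ^ 2 = ∑ i ∈ s, ‖w i‖ ^ 2 * ‖d i‖ ^ 2 := by
  classical
  have : ((‖∑ i ∈ s, d i • w i‖ ^ 2 : ℝ) : ℂ) = ((∑ i ∈ s, ‖w i‖ ^ 2 * ‖d i‖ ^ 2 : ℝ) : ℂ) := by
    push_cast
    have h0 := inner_self_eq_norm_sq_to_K (𝕜 := ℂ) (∑ i ∈ s, d i • w i)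
    simp only [Complex.coe_algebraMap] at h0
    rw [← h0]
    simp_rw [sum_inner, inner_sum, inner_smul_left, inner_smul_right]
    refine Finset.sum_congr rfl fun i hi => ?_
    rw [Finset.sum_eq_single i]
    · have h1 := inner_self_eq_norm_sq_to_K (𝕜 := ℂ) (w i)
      simp only [Complex.coe_algebraMap] at h1
      rw [h1, ← Complex.mul_conj']
      ring
    · intro j _ hji
      rw [hw hji.symm]
      simp
    · exact fun h => absurd hi h
  exact_mod_cast this

/-- `(ξ_i)` is orthonormal and `(A ξ_i)` is orthogonal with norms `(t_i)`. -/
structure IsDiagonalFamily (A : EllTwo →L[ℂ] EllTwo) (t : ι → ℝ) (ξ : ι → EllTwo) : Prop where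
  orthonormal : Orthonormal ℂ ξ
  orthogonal : Pairwise fun i j => ⟪A (ξ i), A (ξ j)⟫_ℂ = 0
  norm_map : ∀ i, ‖A (ξ i)‖ = t i

theorem IsDiagonalFamily.matNorm_le_iff {A : EllTwo →L[ℂ] EllTwo} {t : ι → ℝ} {ξ : ι → EllTwo}
    (h : IsDiagonalFamily A t ξ) {n : ℕ} (s : Finset ι) (a : ι → Matrix (Fin n) (Fin n) ℂ)
    {c : ℝ} (hc : 0 ≤ c) :
    matNorm (tensorSum s a (fun i => toX A (ξ i))) ≤ c ↔ WeightedBound t s a c := by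
  rw [matNorm_tensorSum_toX_le_iff A s a ξ hc, WeightedBound]
  have h1 (d : ι → ℂ) : ‖∑ i ∈ s, d i • ξ i‖ ^ 2 = ∑ i ∈ s, ‖d i‖ ^ 2 := by
    rw [norm_sq_sum_smul_of_orthogonal s d ξ h.orthonormal.2]
    simp [h.orthonormal.1]
  have h2 (d : ι → ℂ) : ‖A (∑ i ∈ s, d i • ξ i)‖ ^ 2 = ∑ i ∈ s, t i ^ 2 * ‖d i‖ ^ 2 := by
    simp_rw [map_sum, map_smul]
    rw [norm_sq_sum_smul_of_orthogonal s d (fun i => A (ξ i)) h.orthogonal]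
    simp [h.norm_map]
  simp_rw [h1, h2]

theorem IsDiagonalFamily.isCompletelyUnconditional {A : EllTwo →L[ℂ] EllTwo} {t : ι → ℝ}
    {ξ : ι → EllTwo} (h : IsDiagonalFamily A t ξ) :
    IsCompletelyUnconditional 1 (fun i => toX A (ξ i)) := by
  refine ⟨le_rfl, fun n s a l hl => ?_⟩
  rw [one_mul, h.matNorm_le_iff _ _ (matNorm_nonneg _)]
  exact ((h.matNorm_le_iff _ _ (matNorm_nonneg _)).1 le_rfl).smul hl

theorem isDiagonalFamily_stdBasis (α : ℕ → unitInterval) (π : ι ↪ ℕ) :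
    IsDiagonalFamily (diag α) (fun i => (α (π i) : ℝ)) (fun i => stdBasis (π i)) := by
  have hd (i : ℕ) : diag α (stdBasis i) = ((α i : ℝ) : ℂ) • stdBasis i := by
    ext j
    rw [diag_apply, lp.coeFn_smul, Pi.smul_apply, smul_eq_mul]
    rcases eq_or_ne j i with rfl | h
    · rfl
    · simp [stdBasis, h]
  have ho {i j : ι} (h : i ≠ j) : ⟪stdBasis (π i), stdBasis (π j)⟫_ℂ = 0 := by
    rw [stdBasis, lp.inner_single_left, stdBasis]
    simp [π.injective.ne h]
  refine ⟨⟨fun i => norm_stdBasis _, fun i j h => ho h⟩, fun i j h => ?_, fun i => ?_⟩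
  · simp only [hd, inner_smul_left, inner_smul_right, ho h, mul_zero]
  · rw [hd, norm_smul, norm_stdBasis, mul_one, Complex.norm_real,
      Real.norm_of_nonneg (α (π i)).2.1]

end Weighted

/-! ### The block sequence and the placement of weights in it. -/

section GeometricSequence

/-- The sequence which takes the value `r ^ k` on the block `b ^ k ≤ i + 1 < b ^ (k + 1)`. -/
noncomputable def blockSeq (r : unitInterval) (b : ℕ) (i : ℕ) : unitInterval :=
  r ^ Nat.log b (i + 1)

theorem coe_blockSeq (r : unitInterval) (b i : ℕ) :
    (blockSeq r b i : ℝ) = (r : ℝ) ^ Nat.log b (i + 1) := rfl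

theorem blockSeq_mem_SeqS {r : unitInterval} (hr : (r : ℝ) < 1) {b : ℕ} (hb : 2 ≤ b) :
    blockSeq r b ∈ SeqS := by
  constructor
  · intro i j hij
    exact pow_le_pow_right_of_le_one' r.2.2 (Nat.log_mono_right (by omega))
  · rw [tendsto_subtype_rng]
    have h1 : Filter.Tendsto (fun i => Nat.log b (i + 1)) Filter.atTop Filter.atTop := by
      refine Filter.tendsto_atTop.2 fun k => ?_
      filter_upwards [Filter.eventually_ge_atTop (b ^ k)] with i hi
      exact Nat.le_log_of_pow_le hb (by omega)
    exact (tendsto_pow_atTop_nhds_zero_of_lt_one r.2.1 hr).comp h1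

/-- On block `k`, `b ^ k ≤ i + 1` and `b * r² ≥ 1` give `α_i² = r ^ (2k) ≥ b ^ (-k) ≥ 1 / (i + 1)`.
-/
theorem not_summable_sq_blockSeq {r : unitInterval} {b : ℕ} (hr : 1 ≤ b * (r : ℝ) ^ 2)
    (hb : 2 ≤ b) : ¬ Summable fun i => (blockSeq r b i : ℝ) ^ 2 := by
  intro h
  refine Real.not_summable_one_div_natCast ((summable_nat_add_iff 1).1 ?_)
  refine Summable.of_nonneg_of_le (fun i => by positivity) (fun i => ?_) h
  have hb0 : (0 : ℝ) < b := by positivity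
  set k := Nat.log b (i + 1)
  have h1 : (b : ℝ) ^ k ≤ ((i + 1 : ℕ) : ℝ) := by
    exact_mod_cast Nat.pow_log_le_self b (Nat.succ_ne_zero i)
  have h2 : 1 ≤ (b : ℝ) ^ k * ((r : ℝ) ^ k) ^ 2 := by
    rw [← pow_mul, mul_comm k 2, pow_mul, ← mul_pow]
    exact one_le_pow₀ hr
  rw [coe_blockSeq, div_le_iff₀ (by positivity), mul_comm]
  exact h2.trans (by gcongr)

/-- Weights in `(r ^ (k+1), r ^ k]` go to block `k + 1 + m`, which has at least `b ^ (k+1+m)`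
places, as many as there can be weights above `r ^ (k+1)`. The value there is `r ^ (k+1+m)`, whence
the ratio. The shift `m` pays for a larger count. -/
theorem exists_orderEmbedding_blockSeq {ι : Type*} [LinearOrder ι] {r : unitInterval}
    (hr0 : 0 < (r : ℝ)) (hr : (r : ℝ) < 1) {b : ℕ} (hb : 2 ≤ b) (m : ℕ) {t : ι → ℝ}
    (ht : Antitone t) (ht0 : ∀ i, 0 < t i) (ht1 : ∀ i, t i ≤ 1)
    (hcard : ∀ (k : ℕ) (F : Finset ι), (∀ i ∈ F, (r : ℝ) ^ (k + 1) < t i) →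
      F.card ≤ b ^ (k + 1 + m)) :
    ∃ π : ι ↪o ℕ, ∀ i, (blockSeq r b (π i) : ℝ) ≤ t i ∧
      t i ≤ (r : ℝ)⁻¹ ^ (m + 1) * blockSeq r b (π i) := by
  choose k hk1 hk2 using fun i => exists_nat_pow_near_of_lt_one (ht0 i) (ht1 i) hr0 hr
  have hF (i : ι) (F : Finset ι) (h : (F : Set ι) ⊆ Set.Iic i) : F.card ≤ b ^ (k i + 1 + m) :=
    hcard _ _ fun j hj => (hk1 i).trans_le (ht (h hj))
  have hfin (i : ι) : (Set.Iic i).Finite := by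
    by_contra hinf
    obtain ⟨F, hF1, hF2⟩ := Set.Infinite.exists_subset_card_eq hinf (b ^ (k i + 1 + m) + 1)
    have := hF i F hF1
    omega
  have hle (i : ι) : (Set.Iic i).ncard ≤ b ^ (k i + 1 + m) := by
    rw [Set.ncard_eq_toFinset_card _ (hfin i)]
    exact hF i _ (by simp)
  have hlt (i : ι) : (Set.Iio i).ncard < b ^ (k i + 1 + m) :=
    (Set.ncard_lt_ncard (Set.Iio_ssubset_Iic_self) (hfin i)).trans_le (hle i)
  have hkmono {i j : ι} (hij : i < j) : k i ≤ k j := by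
    by_contra! h
    have h1 := pow_le_pow_of_le_one hr0.le hr.le h
    exact absurd (ht hij.le) (not_le.2 ((hk2 i).trans_lt (h1.trans_lt (hk1 j))))
  -- The block starts at `b ^ (k+1+m) - 1`, since `blockSeq` takes the logarithm of `i + 1`. The
  -- offset by the number of predecessors makes `π` strictly increasing even within a block.
  let π : ι → ℕ := fun i => b ^ (k i + 1 + m) - 1 + (Set.Iio i).ncard
  have hπ : StrictMono π := by
    intro i j hij
    have h1 : (Set.Iio i).ncard < (Set.Iio j).ncard :=
      Set.ncard_lt_ncard (Set.Iio_ssubset_Iio hij) ((hfin j).subset Set.Iio_subset_Iic_self)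
    have h2 : b ^ (k i + 1 + m) ≤ b ^ (k j + 1 + m) :=
      Nat.pow_le_pow_right (by omega) (by have := hkmono hij; omega)
    simp only [π]
    omega
  have hlog (i : ι) : Nat.log b (π i + 1) = k i + 1 + m := by
    have h0 : 0 < b ^ (k i + 1 + m) := Nat.pow_pos (by omega)
    have h1 : b ^ (k i + 1 + m) * 2 ≤ b ^ (k i + 1 + m + 1) := by
      rw [pow_succ]
      exact Nat.mul_le_mul_left _ hb
    have h2 := hlt i
    refine Nat.log_eq_of_pow_le_of_lt_pow ?_ ?_ <;> simp only [π] <;> omega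
  refine ⟨OrderEmbedding.ofStrictMono π hπ, fun i => ?_⟩
  rw [OrderEmbedding.coe_ofStrictMono, coe_blockSeq, hlog]
  constructor
  · exact (pow_le_pow_of_le_one hr0.le hr.le (by omega)).trans (hk1 i).le
  · refine (hk2 i).trans_eq ?_
    rw [show k i + 1 + m = (m + 1) + k i by ring, pow_add (r : ℝ), ← mul_assoc, ← mul_pow,
      inv_mul_cancel₀ hr0.ne', one_pow, one_mul]

theorem exists_embedding_blockSeq {ι : Type*} {r : unitInterval}
    (hr0 : 0 < (r : ℝ)) (hr : (r : ℝ) < 1) {b : ℕ} (hb : 2 ≤ b) (m : ℕ) {t : ι → ℝ}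
    (ht0 : ∀ i, 0 < t i) (ht1 : ∀ i, t i ≤ 1)
    (hcard : ∀ (k : ℕ) (F : Finset ι), (∀ i ∈ F, (r : ℝ) ^ (k + 1) < t i) →
      F.card ≤ b ^ (k + 1 + m)) :
    ∃ π : ι ↪ ℕ, ∀ i, (blockSeq r b (π i) : ℝ) ≤ t i ∧
      t i ≤ (r : ℝ)⁻¹ ^ (m + 1) * blockSeq r b (π i) := by
  classical
  let W : LinearOrder ι := linearOrderOfSTO WellOrderingRel
  -- Indices are sorted by decreasing weight, ties being broken by an arbitrary well-order.
  let f : ι → Lex (ℝᵒᵈ × ι) := fun i => toLex (OrderDual.toDual (t i), i)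
  have hf : Function.Injective f := fun i j h => congrArg (fun z => (ofLex z).2) h
  have hle (i j : ι) (h : f i ≤ f j) : t j ≤ t i := by
    rcases Prod.Lex.le_iff.1 h with h | h
    · exact (show t j < t i from h).le
    · exact (show t i = t j from h.1).ge
  let L : LinearOrder ι := LinearOrder.lift' f hf
  have hanti : @Antitone ι ℝ L.toPreorder _ t := fun i j hij => hle i j hij
  obtain ⟨π, hπ⟩ := @exists_orderEmbedding_blockSeq ι L r hr0 hr b hb m t hanti ht0 ht1 hcard
  exact ⟨π.toEmbedding, hπ⟩

end GeometricSequence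

/-! ### Compactness of diagonal operators and the counting of singular values. -/

section Diag

theorem norm_diag_apply_le {α : ℕ → unitInterval} {v : ℝ} {ξ : EllTwo}
    (h : ∀ j, (α j : ℝ) * ‖ξ j‖ ≤ v * ‖ξ j‖) : ‖diag α ξ‖ ≤ |v| * ‖ξ‖ := by
  have : ‖diag α ξ‖ ≤ ‖(v : ℂ) • ξ‖ := by
    refine lp.norm_mono two_ne_zero fun j => ?_
    rw [diag_apply, norm_mul, Complex.norm_real, Real.norm_of_nonneg (α j).2.1, lp.coeFn_smul,
      Pi.smul_apply, norm_smul, Complex.norm_real]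
    exact (h j).trans (mul_le_mul_of_nonneg_right (le_abs_self v) (norm_nonneg _))
  rwa [norm_smul, Complex.norm_real] at this

theorem norm_diag_le_one (α : ℕ → unitInterval) : ‖diag α‖ ≤ 1 :=
  ContinuousLinearMap.opNorm_le_bound _ zero_le_one fun ξ => by
    simpa using norm_diag_apply_le (v := 1) (ξ := ξ) fun j =>
      mul_le_mul_of_nonneg_right (α j).2.2 (norm_nonneg _)

theorem diag_injective {α : ℕ → unitInterval} (hα : ∀ i, 0 < (α i : ℝ)) :
    Function.Injective (diag α) := by
  refine (injective_iff_map_eq_zero _).2 fun ξ h => ?_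
  ext i
  have := congrArg (fun z : EllTwo => z i) h
  simp only [diag_apply] at this
  exact (mul_eq_zero.1 this).resolve_left (by exact_mod_cast (hα i).ne')

theorem inner_stdBasis_left (j : ℕ) (ξ : EllTwo) : ⟪stdBasis j, ξ⟫_ℂ = ξ j := by
  simp [stdBasis, lp.inner_single_left]

theorem isCompactOperator_rankOne {F G : Type*} [NormedAddCommGroup F] [InnerProductSpace ℂ F]
    [NormedAddCommGroup G] [InnerProductSpace ℂ G] (x : G) (y : F) :
    IsCompactOperator (InnerProductSpace.rankOne ℂ x y : F →L[ℂ] G) :=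
  (isCompactOperator_of_locallyCompactSpace_rng
    (ContinuousLinearMap.toSpanSingleton ℂ x)).comp_clm (innerSL ℂ y)

theorem isCompactOperator_diag {α : ℕ → unitInterval} (hα : α ∈ SeqS) :
    IsCompactOperator (diag α) := by
  let T : ℕ → EllTwo →L[ℂ] EllTwo := fun M => ∑ j ∈ Finset.range M,
    (((α j : ℝ) : ℂ) • InnerProductSpace.rankOne ℂ (stdBasis j) (stdBasis j))
  have hT (M : ℕ) : IsCompactOperator (T M) := by
    change T M ∈ compactOperator (RingHom.id ℂ) EllTwo EllTwo
    refine Submodule.sum_mem _ fun j _ => Submodule.smul_mem _ _ ?_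
    exact isCompactOperator_rankOne _ _
  have hTapply (M : ℕ) (ξ : EllTwo) (i : ℕ) :
      T M ξ i = if i < M then ((α i : ℝ) : ℂ) * ξ i else 0 := by
    simp only [T, sum_apply, smul_apply, InnerProductSpace.rankOne_apply, inner_stdBasis_left]
    rw [lp.coeFn_sum, Finset.sum_apply]
    simp only [lp.coeFn_smul, Pi.smul_apply, smul_eq_mul, stdBasis, lp.single_apply,
      Pi.single_apply, mul_ite, mul_one, mul_zero, Finset.sum_ite_eq, Finset.mem_range]
  refine isCompactOperator_of_tendsto (F := T) (l := Filter.atTop) ?_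
    (Filter.Eventually.of_forall hT)
  have hlim : Filter.Tendsto (fun M => (α M : ℝ)) Filter.atTop (nhds 0) :=
    (tendsto_subtype_rng.1 hα.2)
  refine tendsto_iff_norm_sub_tendsto_zero.2
    (squeeze_zero (fun _ => norm_nonneg _) (fun M => ?_) hlim)
  refine ContinuousLinearMap.opNorm_le_bound _ (α M).2.1 fun ξ => ?_
  have : ‖(T M - diag α) ξ‖ ≤ ‖((α M : ℝ) : ℂ) • ξ‖ := by
    refine lp.norm_mono two_ne_zero fun i => ?_
    rw [sub_apply, lp.coeFn_sub, Pi.sub_apply, hTapply, diag_apply, lp.coeFn_smul,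
      Pi.smul_apply, norm_smul]
    split_ifs with h
    · rw [sub_self, norm_zero]
      positivity
    · rw [zero_sub, norm_neg, norm_mul, Complex.norm_real, Complex.norm_real,
        Real.norm_of_nonneg (α i).2.1, Real.norm_of_nonneg (α M).2.1]
      gcongr
      exact hα.1 (not_lt.1 h)
  rwa [norm_smul, Complex.norm_real, Real.norm_of_nonneg (α M).2.1] at this

/-- With more than `M` indices, some nonzero combination `η` of the `ξ_i` vanishes in the first `M`
coordinates, so `‖diag α η‖ ≤ α_M ‖η‖`; orthogonality of the family and `t_i > α_M` give the
opposite strict inequality. -/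
theorem IsDiagonalFamily.card_le {ι : Type*} {α : ℕ → unitInterval} (hα : Antitone α) {t : ι → ℝ}
    {ξ : ι → EllTwo} (h : IsDiagonalFamily (diag α) t ξ) (M : ℕ) (F : Finset ι)
    (hF : ∀ i ∈ F, (α M : ℝ) < t i) : F.card ≤ M := by
  classical
  by_contra! hlt
  let φ : (F → ℂ) →ₗ[ℂ] (Fin M → ℂ) :=
    { toFun := fun d j => ∑ i, d i * ξ i j
      map_add' := fun d e => by ext j; simp [add_mul, Finset.sum_add_distrib]
      map_smul' := fun c d => by ext j; simp [Finset.mul_sum, mul_assoc] }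
  have hker : LinearMap.ker φ ≠ ⊥ := LinearMap.ker_ne_bot_of_finrank_lt (by simpa using hlt)
  obtain ⟨d, hd, hd0⟩ := (Submodule.ne_bot_iff _).1 hker
  set η : EllTwo := ∑ i : F, d i • ξ i with hη
  have h1 : ‖η‖ ^ 2 = ∑ i : F, ‖d i‖ ^ 2 := by
    rw [hη, norm_sq_sum_smul_of_orthogonal _ d (fun i : F => ξ i)
      fun i j hij => h.orthonormal.2 (Subtype.coe_injective.ne hij)]
    simp [h.orthonormal.1]
  have h2 : ‖diag α η‖ ^ 2 = ∑ i : F, t i ^ 2 * ‖d i‖ ^ 2 := by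
    simp_rw [hη, map_sum, map_smul]
    rw [norm_sq_sum_smul_of_orthogonal _ d (fun i : F => diag α (ξ i))
      fun i j hij => h.orthogonal (Subtype.coe_injective.ne hij)]
    simp [h.norm_map]
  have h3 : ‖diag α η‖ ≤ |(α M : ℝ)| * ‖η‖ := by
    refine norm_diag_apply_le fun j => ?_
    by_cases hj : j < M
    · have : η j = 0 := by
        have h4 := congrFun (LinearMap.mem_ker.1 hd) ⟨j, hj⟩
        rw [hη, lp.coeFn_sum, Finset.sum_apply]
        exact h4
      simp [this]
    · gcongr
      exact hα (not_lt.1 hj)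
  have h4 : ∑ i : F, (α M : ℝ) ^ 2 * ‖d i‖ ^ 2 < ∑ i : F, t i ^ 2 * ‖d i‖ ^ 2 := by
    have hsq (i : F) : (α M : ℝ) ^ 2 < t i ^ 2 :=
      pow_lt_pow_left₀ (hF i i.2) (α M).2.1 two_ne_zero
    obtain ⟨i, hi⟩ := Function.ne_iff.1 hd0
    refine Finset.sum_lt_sum (fun j _ => ?_) ⟨i, Finset.mem_univ _, ?_⟩
    · exact mul_le_mul_of_nonneg_right (hsq j).le (by positivity)
    · exact mul_lt_mul_of_pos_right (hsq i) (by positivity [norm_pos_iff.2 hi])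
  rw [← Finset.mul_sum, ← h1, ← h2, ← mul_pow] at h4
  rw [abs_of_nonneg (α M).2.1] at h3
  exact absurd (pow_le_pow_left₀ (norm_nonneg _) h3 2) (not_le.2 h4)

end Diag

/-! ### Singular value decomposition. -/

section SingularBasis

variable {F G : Type*} [NormedAddCommGroup F] [InnerProductSpace ℂ F] [CompleteSpace F]
  [NormedAddCommGroup G] [InnerProductSpace ℂ G] [CompleteSpace G]

theorem IsSingularBasis.inner_map {T : F →L[ℂ] G} {ι : Type*} {s : ι → ℝ} {ξ : ι → F}
    (h : IsSingularBasis T s ξ) (i j : ι) :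
    ⟪T (ξ i), T (ξ j)⟫_ℂ = (s j : ℂ) ^ 2 * ⟪ξ i, ξ j⟫_ℂ := by
  rw [← ContinuousLinearMap.adjoint_inner_right, (h.2.2 j).2, inner_smul_right]

theorem IsSingularBasis.norm_map {T : F →L[ℂ] G} {ι : Type*} {s : ι → ℝ} {ξ : ι → F}
    (h : IsSingularBasis T s ξ) (i : ι) : ‖T (ξ i)‖ = s i := by
  have h1 := h.inner_map i i
  rw [inner_self_eq_norm_sq_to_K, inner_self_eq_norm_sq_to_K, h.1.1 i] at h1
  simp only [Complex.coe_algebraMap, Complex.ofReal_one, one_pow, mul_one] at h1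
  norm_cast at h1
  exact (pow_left_inj₀ (norm_nonneg _) (h.2.2 i).1 two_ne_zero).1 h1

/-- Singular value decomposition of compact operators. -/
theorem exists_isSingularBasis {F G : Type} [NormedAddCommGroup F] [InnerProductSpace ℂ F]
    [CompleteSpace F] [NormedAddCommGroup G] [InnerProductSpace ℂ G] [CompleteSpace G]
    {T : F →L[ℂ] G} (hT : IsCompactOperator T) :
    ∃ (ι : Type) (s : ι → ℝ) (ξ : ι → F), IsSingularBasis T s ξ := by
  let S : F →L[ℂ] F := ContinuousLinearMap.adjoint T ∘L T
  have hScomp : IsCompactOperator S := hT.clm_comp (ContinuousLinearMap.adjoint T)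
  have hSsymm : (S : F →ₗ[ℂ] F).IsSymmetric := fun x y => by
    simp [S, ContinuousLinearMap.adjoint_inner_left, ContinuousLinearMap.adjoint_inner_right]
  have hclosed (μ : ℂ) : IsClosed (Module.End.eigenspace (S : Module.End ℂ F) μ : Set F) := by
    have : (Module.End.eigenspace (S : Module.End ℂ F) μ : Set F) = {x | S x = μ • x} := by
      ext x
      exact Module.End.mem_eigenspace_iff
    rw [this]
    exact isClosed_eq S.continuous (continuous_const_smul μ)
  have (μ : ℂ) : CompleteSpace (Module.End.eigenspace (S : Module.End ℂ F) μ) :=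
    (hclosed μ).completeSpace_coe
  -- Every eigenspace is used, including that of `0`, so the kernel of `T` also receives a basis.
  choose w b hb using fun μ : ℂ =>
    exists_hilbertBasis ℂ (Module.End.eigenspace (S : Module.End ℂ F) μ)
  let ξ : (Σ μ, w μ) → F := fun i => (b i.1 i.2 : F)
  have hξ : Orthonormal ℂ ξ :=
    hSsymm.orthogonalFamily_eigenspaces.orthonormal_sigma_orthonormal fun μ => (b μ).orthonormal
  have heig (i : Σ μ, w μ) : S (ξ i) = i.1 • ξ i :=
    Module.End.mem_eigenspace_iff.1 (b i.1 i.2).2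
  refine ⟨_, fun i => ‖T (ξ i)‖, ξ, hξ, ?_, fun i => ⟨norm_nonneg _, ?_⟩⟩
  · rw [Submodule.topologicalClosure_eq_top_iff, eq_bot_iff,
      ← ContinuousLinearMap.orthogonalComplement_iSup_eigenspaces_eq_bot hScomp hSsymm]
    rw [← Submodule.orthogonal_closure (Submodule.span ℂ (Set.range ξ))]
    refine Submodule.orthogonal_le (iSup_le fun μ => ?_)
    let P := (Submodule.span ℂ (Set.range ξ)).topologicalClosure
    have h1 : (Submodule.span ℂ (Set.range (b μ))).topologicalClosure ≤
        P.comap (Module.End.eigenspace (S : Module.End ℂ F) μ).subtype := by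
      refine Submodule.topologicalClosure_minimal _ (Submodule.span_le.2 ?_) ?_
      · rintro _ ⟨j, rfl⟩
        exact Submodule.le_topologicalClosure _ (Submodule.subset_span ⟨⟨μ, j⟩, rfl⟩)
      · exact (Submodule.isClosed_topologicalClosure _).preimage continuous_subtype_val
    rw [(b μ).dense_span] at h1
    exact fun x hx => h1 (show (⟨x, hx⟩ : Module.End.eigenspace _ μ) ∈ ⊤ from trivial)
  · have h1 : ⟪ξ i, S (ξ i)⟫_ℂ = ((‖T (ξ i)‖ : ℝ) : ℂ) ^ 2 := by
      simp only [S, ContinuousLinearMap.comp_apply, ContinuousLinearMap.adjoint_inner_right]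
      exact inner_self_eq_norm_sq_to_K _
    have h2 : i.1 = ((‖T (ξ i)‖ : ℝ) : ℂ) ^ 2 := by
      rw [← h1, heig, inner_smul_right, inner_self_eq_norm_sq_to_K, hξ.1]
      simp
    rw [← h2]
    exact heig i

end SingularBasis

/-! ### Canonical bases as diagonal families. -/

section CanonicalBasis

theorem continuous_toX (A : EllTwo →L[ℂ] EllTwo) : Continuous (toX A) := by
  refine AddMonoidHomClass.continuous_of_bound (toX A) (max 1 ‖A‖) fun ξ => ?_
  refine (norm_toX_le_iff A ξ (by positivity)).2 ⟨?_, ?_⟩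
  · exact le_mul_of_one_le_left (norm_nonneg _) (le_max_left _ _)
  · exact (A.le_opNorm ξ).trans (by gcongr; exact le_max_right _ _)

theorem IsSingularBasis.isDiagonalFamily {A : EllTwo →L[ℂ] EllTwo} {V : Submodule ℂ EllTwo}
    [CompleteSpace V] {ι : Type*} {s : ι → ℝ} {ξ : ι → V}
    (h : IsSingularBasis (A ∘L V.subtypeL) s ξ) :
    IsDiagonalFamily A s (fun i => (ξ i : EllTwo)) where
  orthonormal := h.1.comp_linearIsometry V.subtypeₗᵢ
  orthogonal i j hij := by
    have := h.inner_map i j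
    rwa [h.1.2 hij, mul_zero] at this
  norm_map i := h.norm_map i

theorem IsSingularBasis.closedSpan_eq {A : EllTwo →L[ℂ] EllTwo}
    {Y : Submodule ℂ (EllTwoSum →L[ℂ] EllTwoSum)} (hY : IsClosed (Y : Set (EllTwoSum →L[ℂ] EllTwoSum))) (hYX : Y ≤ XSpace A)
    [CompleteSpace (pullback A Y)] {ι : Type*} {s : ι → ℝ} {ξ : ι → pullback A Y}
    (h : IsSingularBasis (A ∘L (pullback A Y).subtypeL) s ξ) :
    Y = closedSpan (fun i => toX A (ξ i)) := by
  apply le_antisymm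
  · intro y hy
    obtain ⟨η, rfl⟩ := hYX hy
    let Z := closedSpan (fun i => toX A (ξ i))
    have hZ : IsClosed (Z : Set (EllTwoSum →L[ℂ] EllTwoSum)) :=
      Submodule.isClosed_topologicalClosure _
    have hcont : Continuous fun z : pullback A Y => toX A z :=
      (continuous_toX A).comp continuous_subtype_val
    have h1 : (Submodule.span ℂ (Set.range ξ)).topologicalClosure ≤
        Z.comap ((toX A) ∘ₗ (pullback A Y).subtype) := by
      refine Submodule.topologicalClosure_minimal _ (Submodule.span_le.2 ?_) (hZ.preimage hcont)
      rintro _ ⟨j, rfl⟩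
      exact mem_closedSpan (fun i => toX A (ξ i)) j
    rw [h.2.1] at h1
    have h2 := h1 (Submodule.mem_top (x := (⟨η, hy⟩ : pullback A Y)))
    rwa [Submodule.mem_comap] at h2
  · refine Submodule.topologicalClosure_minimal _ (Submodule.span_le.2 ?_) hY
    rintro _ ⟨j, rfl⟩
    exact (ξ j).2

/-- The map to the smaller weights is completely contractive, so the whole distortion comes from its
inverse and is `μ`. -/
theorem IsDiagonalFamily.areEquivalent {ι : Type*} {A A' : EllTwo →L[ℂ] EllTwo} {t t' : ι → ℝ}
    {ξ ξ' : ι → EllTwo} (h : IsDiagonalFamily A t ξ) (h' : IsDiagonalFamily A' t' ξ') {μ : ℝ}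
    (hμ : 1 ≤ μ) (h1 : ∀ i, t' i ≤ t i) (h2 : ∀ i, t i ≤ μ * t' i) :
    AreEquivalent μ (fun i => toX A (ξ i)) (fun i => toX A' (ξ' i)) := by
  have ht (i : ι) : 0 ≤ t i := h.norm_map i ▸ norm_nonneg _
  have ht' (i : ι) : 0 ≤ t' i := h'.norm_map i ▸ norm_nonneg _
  refine areEquivalent_of_matNorm_le zero_le_one (zero_le_one.trans hμ) (one_mul μ).le
    (fun n s a => ?_) fun n s a => ?_
  · refine (h'.matNorm_le_iff s a (mul_nonneg zero_le_one (matNorm_nonneg _))).2 ?_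
    exact ((h.matNorm_le_iff s a (matNorm_nonneg _)).1 le_rfl).mono_weight le_rfl ht'
      (by simpa using h1)
  · refine (h.matNorm_le_iff s a
      (mul_nonneg (zero_le_one.trans hμ) (matNorm_nonneg _))).2 ?_
    exact ((h'.matNorm_le_iff s a (matNorm_nonneg _)).1 le_rfl).mono_weight hμ ht h2

end CanonicalBasis

/-! ### Canonical bases in the space of the block sequence. -/

section BlockSeq

variable {r : unitInterval} {b : ℕ} {ι : Type*} {t : ι → ℝ} {ξ : ι → EllTwo}

theorem IsDiagonalFamily.card_le_of_blockSeq (hr : (r : ℝ) < 1) (hb : 2 ≤ b)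
    (h : IsDiagonalFamily (diag (blockSeq r b)) t ξ) (k : ℕ) (F : Finset ι)
    (hF : ∀ i ∈ F, (r : ℝ) ^ (k + 1) < t i) : F.card ≤ b ^ (k + 1 + 0) := by
  refine (h.card_le (blockSeq_mem_SeqS hr hb).1 (b ^ (k + 1)) F fun i hi => ?_)
  refine lt_of_le_of_lt ?_ (hF i hi)
  exact pow_le_pow_of_le_one r.2.1 r.2.2 (Nat.le_log_of_pow_le hb (by omega))

theorem blockSeq_pos (hr0 : 0 < (r : ℝ)) (i : ℕ) : 0 < (blockSeq r b i : ℝ) := by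
  rw [coe_blockSeq]
  positivity

theorem IsDiagonalFamily.pos_and_le_one (hr0 : 0 < (r : ℝ))
    (h : IsDiagonalFamily (diag (blockSeq r b)) t ξ) (i : ι) : 0 < t i ∧ t i ≤ 1 := by
  rw [← h.norm_map]
  constructor
  · refine norm_pos_iff.2 fun h0 => h.orthonormal.ne_zero i ?_
    exact diag_injective (blockSeq_pos hr0) (h0.trans (map_zero _).symm)
  · exact ((diag _).le_of_opNorm_le (norm_diag_le_one _) _).trans (by simp [h.orthonormal.1])

theorem IsDiagonalFamily.exists_orderEmbedding [LinearOrder ι] (hr0 : 0 < (r : ℝ))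
    (hr : (r : ℝ) < 1) (hb : 2 ≤ b) (h : IsDiagonalFamily (diag (blockSeq r b)) t ξ)
    (ht : Antitone t) : ∃ π : ι ↪o ℕ, AreEquivalent (r : ℝ)⁻¹
      (fun i => toX (diag (blockSeq r b)) (ξ i)) (fun i => canonicalBasis (blockSeq r b) (π i)) := by
  obtain ⟨π, hπ⟩ := exists_orderEmbedding_blockSeq hr0 hr hb 0 ht
    (fun i => (h.pos_and_le_one hr0 i).1) (fun i => (h.pos_and_le_one hr0 i).2)
    (h.card_le_of_blockSeq hr hb)
  exact ⟨π, h.areEquivalent (isDiagonalFamily_stdBasis _ π.toEmbedding)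
    ((one_le_inv₀ hr0).2 hr.le) (fun i => (hπ i).1) (fun i => by simpa using (hπ i).2)⟩

theorem IsDiagonalFamily.exists_embedding (hr0 : 0 < (r : ℝ))
    (hr : (r : ℝ) < 1) (hb : 2 ≤ b) (h : IsDiagonalFamily (diag (blockSeq r b)) t ξ) :
    ∃ π : ι ↪ ℕ, AreEquivalent (r : ℝ)⁻¹
      (fun i => toX (diag (blockSeq r b)) (ξ i)) (fun i => canonicalBasis (blockSeq r b) (π i)) := by
  obtain ⟨π, hπ⟩ := exists_embedding_blockSeq hr0 hr hb 0
    (fun i => (h.pos_and_le_one hr0 i).1) (fun i => (h.pos_and_le_one hr0 i).2)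
    (h.card_le_of_blockSeq hr hb)
  exact ⟨π, h.areEquivalent (isDiagonalFamily_stdBasis _ π)
    ((one_le_inv₀ hr0).2 hr.le) (fun i => (hπ i).1) (fun i => by simpa using (hπ i).2)⟩

theorem exists_isCanonicalBasis (hr0 : 0 < (r : ℝ)) (hr : (r : ℝ) < 1) (hb : 2 ≤ b)
    {Y : Submodule ℂ (EllTwoSum →L[ℂ] EllTwoSum)} (hY : IsClosed (Y : Set (EllTwoSum →L[ℂ] EllTwoSum))) :
    ∃ (ι : Type) (_ : Countable ι) (s : ι → ℝ) (f : ι → (EllTwoSum →L[ℂ] EllTwoSum)),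
      IsCanonicalBasis (diag (blockSeq r b)) Y s f := by
  have hc : CompleteSpace (pullback (diag (blockSeq r b)) Y) :=
    (hY.preimage (continuous_toX _)).completeSpace_coe
  obtain ⟨ι, s, ξ, h⟩ := exists_isSingularBasis
    (T := diag (blockSeq r b) ∘L (pullback (diag (blockSeq r b)) Y).subtypeL)
    ((isCompactOperator_diag (blockSeq_mem_SeqS hr hb)).comp_clm
      (pullback (diag (blockSeq r b)) Y).subtypeL)
  obtain ⟨π, -⟩ := h.isDiagonalFamily.exists_embedding hr0 hr hb
  exact ⟨ι, π.injective.countable, s, _, hc, ξ, h, fun i => rfl⟩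

end BlockSeq

/-! ### Averaging over signs. -/

section Signs

variable {ι : Type*}

theorem two_pow_mul_le_sum_powerset {s : Finset ι} {X : ℝ} {f : Finset ι → ℝ}
    (h : ∀ T, X ≤ f T) : 2 ^ s.card * X ≤ ∑ T ∈ s.powerset, f T := by
  have := Finset.card_nsmul_le_sum s.powerset f X fun T _ => h T
  rwa [Finset.card_powerset, nsmul_eq_mul, Nat.cast_pow, Nat.cast_ofNat] at this

theorem sum_powerset_le_two_pow_mul {s : Finset ι} {X : ℝ} {f : Finset ι → ℝ}
    (h : ∀ T, f T ≤ X) : ∑ T ∈ s.powerset, f T ≤ 2 ^ s.card * X := by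
  have := Finset.sum_le_card_nsmul s.powerset f X fun T _ => h T
  rwa [Finset.card_powerset, nsmul_eq_mul, Nat.cast_pow, Nat.cast_ofNat] at this

variable [DecidableEq ι]

/-- The choice of signs which is `1` on `T` and `-1` off `T`. -/
def signOf (T : Finset ι) (i : ι) : ℂ := if i ∈ T then 1 else -1

theorem norm_signOf (T : Finset ι) (i : ι) : ‖signOf T i‖ = 1 := by
  unfold signOf
  split_ifs <;> simp

theorem signOf_mul_self (T : Finset ι) (i : ι) : signOf T i * signOf T i = 1 := by
  unfold signOf
  split_ifs <;> simp

/-- Orthogonality of random signs. A new index `a` pairs `T` with `insert a T`, and the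
parallelogram law removes the cross term. -/
theorem sum_powerset_norm_sq_sum_signOf_smul {H : Type*} [NormedAddCommGroup H]
    [InnerProductSpace ℂ H] (s : Finset ι) (w : ι → H) :
    ∑ T ∈ s.powerset, ‖∑ i ∈ s, signOf T i • w i‖ ^ 2 = 2 ^ s.card * ∑ i ∈ s, ‖w i‖ ^ 2 := by
  induction s using Finset.induction_on with
  | empty => simp
  | insert a s ha ih =>
    rw [Finset.sum_powerset_insert ha, ← Finset.sum_add_distrib, Finset.card_insert_of_notMem ha,
      Finset.sum_insert ha]
    have h1 : ∀ T ∈ s.powerset, ‖∑ i ∈ insert a s, signOf T i • w i‖ ^ 2 +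
        ‖∑ i ∈ insert a s, signOf (insert a T) i • w i‖ ^ 2 =
          2 * ‖∑ i ∈ s, signOf T i • w i‖ ^ 2 + 2 * ‖w a‖ ^ 2 := by
      intro T hT
      have haT : a ∉ T := fun h => ha (Finset.mem_powerset.1 hT h)
      have h2 : ∑ i ∈ s, signOf (insert a T) i • w i = ∑ i ∈ s, signOf T i • w i := by
        refine Finset.sum_congr rfl fun i hi => ?_
        have : i ≠ a := fun h => ha (h ▸ hi)
        simp [signOf, this]
      rw [Finset.sum_insert ha, Finset.sum_insert ha, h2]
      have h3 := parallelogram_law_with_norm ℂ (∑ i ∈ s, signOf T i • w i) (w a)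
      have h4 : signOf T a • w a = - w a := by simp [signOf, haT]
      have h5 : signOf (insert a T) a • w a = w a := by simp [signOf]
      rw [h4, h5, add_comm (- w a), ← sub_eq_add_neg, add_comm (w a)]
      linarith
    rw [Finset.sum_congr rfl h1, Finset.sum_add_distrib, ← Finset.mul_sum, ih, Finset.sum_const,
      Finset.card_powerset, nsmul_eq_mul]
    push_cast
    ring

end Signs

/-! ### Consequences of complete unconditionality. -/

section Unconditional

variable {ι : Type*} {A : EllTwo →L[ℂ] EllTwo} {ξ : ι → EllTwo} {C : ℝ}

theorem IsCompletelyUnconditional.norm_sum_le (hA : ‖A‖ ≤ 1)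
    (h : IsCompletelyUnconditional C (fun i => toX A (ξ i))) (s : Finset ι) (d l : ι → ℂ)
    (hl : ∀ i, ‖l i‖ ≤ 1) :
    ‖∑ i ∈ s, l i • d i • ξ i‖ ≤ C * ‖∑ i ∈ s, d i • ξ i‖ := by
  have := h.2 1 s (fun i => Matrix.of fun _ _ => d i) l hl
  rw [matNorm_fin_one, matNorm_fin_one, tensorSum_toX, tensorSum_toX] at this
  simp only [Matrix.of_apply, norm_toX hA, Matrix.smul_apply, smul_assoc] at this
  exact this

theorem IsCompletelyUnconditional.norm_sum_sq_le (hA : ‖A‖ ≤ 1) (hξ : ∀ i, ‖ξ i‖ = 1)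
    (h : IsCompletelyUnconditional C (fun i => toX A (ξ i))) (s : Finset ι) (d : ι → ℂ) :
    ‖∑ i ∈ s, d i • ξ i‖ ^ 2 ≤ C ^ 2 * ∑ i ∈ s, ‖d i‖ ^ 2 := by
  classical
  have h1 := sum_powerset_norm_sq_sum_signOf_smul s fun i => d i • ξ i
  have h2 := two_pow_mul_le_sum_powerset (s := s)
    (f := fun T => C ^ 2 * ‖∑ i ∈ s, signOf T i • d i • ξ i‖ ^ 2)
    (X := ‖∑ i ∈ s, d i • ξ i‖ ^ 2) fun T => by
      have h3 := h.norm_sum_le hA s (fun i => signOf T i * d i) _ fun i => (norm_signOf T i).le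
      simp_rw [smul_smul, ← mul_assoc, signOf_mul_self, one_mul] at h3
      rw [← mul_pow]
      simp_rw [smul_smul]
      gcongr
  rw [← Finset.mul_sum, h1, mul_left_comm] at h2
  have h3 := le_of_mul_le_mul_left h2 (by positivity)
  simpa [norm_smul, hξ, mul_pow] using h3

-- Averaging the row and column inequalities over all sign changes removes the off-diagonal terms.
open Matrix in
theorem IsCompletelyUnconditional.weightedBound (hξ : ∀ i, ‖ξ i‖ = 1)
    (h : IsCompletelyUnconditional C (fun i => toX A (ξ i))) {n : ℕ} (s : Finset ι)
    (a : ι → Matrix (Fin n) (Fin n) ℂ) :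
    WeightedBound (fun i => ‖A (ξ i)‖) s a
      (C * matNorm (tensorSum s a (fun i => toX A (ξ i)))) := by
  classical
  have h0 (T : Finset ι) := (matNorm_tensorSum_toX_le_iff A s (fun i => signOf T i • a i) ξ
    (mul_nonneg (zero_le_one.trans h.1) (matNorm_nonneg _))).1
      (h.2 n s a (signOf T) fun i => (norm_signOf T i).le)
  simp only [Matrix.vecMul_smul, Matrix.smul_mulVec, Pi.smul_apply, smul_assoc] at h0
  refine ⟨fun y => ?_, fun x => ?_⟩
  · have h2 := sum_powerset_le_two_pow_mul (s := s) fun T => (h0 T).1 y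
    rw [Finset.sum_comm] at h2
    simp_rw [sum_powerset_norm_sq_sum_signOf_smul] at h2
    rw [← Finset.mul_sum] at h2
    simpa [norm_smul, hξ] using le_of_mul_le_mul_left h2 (by positivity)
  · have h2 := sum_powerset_le_two_pow_mul (s := s) fun T => (h0 T).2 x
    rw [Finset.sum_comm] at h2
    simp_rw [map_sum, map_smul, sum_powerset_norm_sq_sum_signOf_smul] at h2
    rw [← Finset.mul_sum] at h2
    have h3 := le_of_mul_le_mul_left h2 (by positivity)
    simp_rw [norm_smul, mul_pow, mul_comm (‖_‖ ^ 2) (‖A _‖ ^ 2)] at h3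
    rwa [mul_pow]

-- The test matrices carry `U` in a single column. Their column norm is then a Hilbert–Schmidt sum,
-- while `hU` keeps the row norm below `C`. Unconditionality compares the sum with each of its sign
-- changes, and averaging these leaves the diagonal.
open Matrix in
theorem IsCompletelyUnconditional.sum_norm_sq_map_le (hA : ‖A‖ ≤ 1) (hξ : ∀ i, ‖ξ i‖ = 1)
    (h : IsCompletelyUnconditional C (fun i => toX A (ξ i))) {n : ℕ} (s : Finset ι)
    (U : Fin n → ι → ℂ)
    (hU : ∀ y : Fin n → ℂ, ∑ i ∈ s, ‖∑ p, y p * U p i‖ ^ 2 ≤ ∑ p, ‖y p‖ ^ 2) :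
    ∑ p, ‖A (∑ i ∈ s, U p i • ξ i)‖ ^ 2 ≤
      C ^ 2 * (C ^ 2 + ∑ p, ∑ i ∈ s, ‖A (ξ i)‖ ^ 2 * ‖U p i‖ ^ 2) := by
  classical
  rcases n with _ | n
  · simp only [Finset.univ_eq_empty, Finset.sum_empty]
    positivity
  have hC : 0 ≤ C := zero_le_one.trans h.1
  let a : ι → Matrix (Fin (n + 1)) (Fin (n + 1)) ℂ :=
    fun i => Matrix.of fun p q => if q = 0 then U p i else 0
  have hcol (i : ι) (x : Fin (n + 1) → ℂ) (p : Fin (n + 1)) : (a i *ᵥ x) p = x 0 * U p i := by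
    simp [a, Matrix.mulVec, dotProduct, mul_comm]
  have hrow (i : ι) (y : Fin (n + 1) → ℂ) (q : Fin (n + 1)) :
      (y ᵥ* a i) q = if q = 0 then ∑ p, y p * U p i else 0 := by
    by_cases hq : q = 0 <;> simp [a, Matrix.vecMul, dotProduct, hq]
  -- Under the root, `C ^ 2` bounds the row part and the sum bounds the column part. Adding them
  -- instead of taking the maximum allows averaging over `T`.
  let c : Finset ι → ℝ := fun T =>
    √(C ^ 2 + ∑ p, ‖A (∑ i ∈ s, signOf T i • U p i • ξ i)‖ ^ 2)
  have hc (T : Finset ι) : c T ^ 2 = C ^ 2 + ∑ p, ‖A (∑ i ∈ s, signOf T i • U p i • ξ i)‖ ^ 2 :=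
    Real.sq_sqrt (by positivity)
  have hT (T : Finset ι) :
      matNorm (tensorSum s (fun i => signOf T i • a i) (fun i => toX A (ξ i))) ≤ c T := by
    refine (matNorm_tensorSum_toX_le_iff A s _ ξ (Real.sqrt_nonneg _)).2
      ⟨fun y => ?_, fun x => ?_⟩
    · simp only [Matrix.vecMul_smul, Pi.smul_apply, hrow]
      rw [Finset.sum_eq_single 0 (fun q _ hq => by simp [hq]) (by simp)]
      simp only [if_true]
      calc _ ≤ C ^ 2 * ∑ i ∈ s, ‖signOf T i • ∑ p, y p * U p i‖ ^ 2 :=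
            h.norm_sum_sq_le hA hξ s _
        _ = C ^ 2 * ∑ i ∈ s, ‖∑ p, y p * U p i‖ ^ 2 := by simp_rw [norm_smul, norm_signOf, one_mul]
        _ ≤ c T ^ 2 * ∑ p, ‖y p‖ ^ 2 := by
            rw [hc]
            gcongr
            · exact le_add_of_nonneg_right (by positivity)
            · exact hU y
    · simp only [Matrix.smul_mulVec, Pi.smul_apply, hcol]
      have h1 (p : Fin (n + 1)) : ∑ i ∈ s, (signOf T i • (x 0 * U p i)) • ξ i =
          x 0 • ∑ i ∈ s, signOf T i • U p i • ξ i := by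
        rw [Finset.smul_sum]
        refine Finset.sum_congr rfl fun i _ => ?_
        simp only [smul_smul, smul_eq_mul]
        ring_nf
      simp_rw [h1, map_smul, norm_smul, mul_pow]
      rw [← Finset.mul_sum, mul_comm]
      refine mul_le_mul ?_ ?_ (by positivity) (by positivity)
      · rw [hc]
        exact le_add_of_nonneg_left (by positivity)
      · exact Finset.single_le_sum (f := fun q => ‖x q‖ ^ 2) (fun q _ => by positivity)
          (Finset.mem_univ 0)
  have hN (T : Finset ι) : matNorm (tensorSum s a (fun i => toX A (ξ i))) ≤ C * c T := by
    have h1 := h.2 (n + 1) s (fun i => signOf T i • a i) (signOf T) fun i => (norm_signOf T i).le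
    simp_rw [smul_smul, signOf_mul_self, one_smul] at h1
    exact h1.trans (by gcongr; exact hT T)
  have hfin (T : Finset ι) : ∑ p, ‖A (∑ i ∈ s, U p i • ξ i)‖ ^ 2 ≤ C ^ 2 * c T ^ 2 := by
    have h1 := ((matNorm_tensorSum_toX_le_iff A s a ξ
      (mul_nonneg hC (Real.sqrt_nonneg _))).1 (hN T)).2 (Pi.single 0 1)
    simp only [hcol, Pi.single_eq_same, one_mul] at h1
    have h2 : ∑ q, ‖(Pi.single 0 1 : Fin (n + 1) → ℂ) q‖ ^ 2 = 1 := by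
      rw [Finset.sum_eq_single 0 (fun q _ hq => by simp [hq]) (by simp)]
      simp
    rwa [h2, mul_one, mul_pow] at h1
  have havg := two_pow_mul_le_sum_powerset (s := s) hfin
  simp_rw [hc] at havg
  rw [← Finset.mul_sum, Finset.sum_add_distrib, Finset.sum_const, Finset.card_powerset,
    nsmul_eq_mul, Nat.cast_pow, Nat.cast_ofNat, Finset.sum_comm] at havg
  simp_rw [map_sum, map_smul, sum_powerset_norm_sq_sum_signOf_smul] at havg
  rw [← Finset.mul_sum, ← mul_add, mul_left_comm] at havg
  have h3 := le_of_mul_le_mul_left havg (by positivity)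
  simp_rw [norm_smul, mul_pow, mul_comm (‖U _ _‖ ^ 2) (‖A _‖ ^ 2)] at h3
  simpa only [map_sum, map_smul] using h3

end Unconditional

/-! ### Domination of the column form by its diagonal and a trace class form. -/

section Spectral

theorem exists_norm_sq_eq_norm_sq_add_sum {V G G' : Type*} [NormedAddCommGroup V]
    [InnerProductSpace ℂ V] [FiniteDimensional ℂ V] [NormedAddCommGroup G]
    [InnerProductSpace ℂ G] [CompleteSpace G] [NormedAddCommGroup G'] [InnerProductSpace ℂ G']
    [CompleteSpace G'] (L : V →L[ℂ] G) (D : V →L[ℂ] G') :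
    ∃ (n : ℕ) (u : OrthonormalBasis (Fin n) ℂ V) (μ : Fin n → ℝ),
      ∀ d, ‖L d‖ ^ 2 = ‖D d‖ ^ 2 + ∑ k, μ k * ‖⟪u k, d⟫_ℂ‖ ^ 2 := by
  have := FiniteDimensional.complete ℂ V
  let S : V →L[ℂ] V := ContinuousLinearMap.adjoint L ∘L L - ContinuousLinearMap.adjoint D ∘L D
  have hS : (S : V →ₗ[ℂ] V).IsSymmetric := fun x y => by
    simp [S, inner_sub_left, inner_sub_right, ContinuousLinearMap.adjoint_inner_left,
      ContinuousLinearMap.adjoint_inner_right]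
  refine ⟨_, hS.eigenvectorBasis rfl, hS.eigenvalues rfl, fun d => ?_⟩
  have h1 : ⟪d, S d⟫_ℂ = ((‖L d‖ ^ 2 - ‖D d‖ ^ 2 : ℝ) : ℂ) := by
    simp [S, ContinuousLinearMap.adjoint_inner_right]
  have h2 : ⟪d, S d⟫_ℂ = ((∑ k, hS.eigenvalues rfl k *
      ‖⟪hS.eigenvectorBasis rfl k, d⟫_ℂ‖ ^ 2 : ℝ) : ℂ) := by
    rw [← (hS.eigenvectorBasis rfl).sum_inner_mul_inner d (S d)]
    push_cast
    refine Finset.sum_congr rfl fun k _ => ?_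
    have h3 : ⟪hS.eigenvectorBasis rfl k, S d⟫_ℂ =
        hS.eigenvalues rfl k * ⟪hS.eigenvectorBasis rfl k, d⟫_ℂ := by
      have h4 := hS (hS.eigenvectorBasis rfl k) d
      rw [hS.apply_eigenvectorBasis, inner_smul_left] at h4
      simpa using h4.symm
    rw [h3, mul_left_comm, ← inner_conj_symm d, Complex.conj_mul']
  rw [h1] at h2
  have := Complex.ofReal_injective h2
  linarith

end Spectral

section Domination

variable {ι : Type*} {A : EllTwo →L[ℂ] EllTwo} {ξ : ι → EllTwo} {C : ℝ}

/-- The column form of a completely unconditional family is dominated by its diagonal up to a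
trace class form. -/
theorem IsCompletelyUnconditional.exists_norm_sq_map_sum_le (hA : ‖A‖ ≤ 1) (hξ : ∀ i, ‖ξ i‖ = 1)
    (h : IsCompletelyUnconditional C (fun i => toX A (ξ i))) (s : Finset ι) :
    ∃ (n : ℕ) (w : Fin n → ι → ℂ),
      (∀ d : ι → ℂ, ‖A (∑ i ∈ s, d i • ξ i)‖ ^ 2 ≤
        C ^ 2 * ∑ i ∈ s, ‖A (ξ i)‖ ^ 2 * ‖d i‖ ^ 2 + ∑ k, ‖∑ i ∈ s, w k i * d i‖ ^ 2) ∧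
      ∑ k, ∑ i ∈ s, ‖w k i‖ ^ 2 ≤ C ^ 4 := by
  classical
  have hC : 0 ≤ C := zero_le_one.trans h.1
  let L : EuclideanSpace ℂ s →L[ℂ] EllTwo := ∑ i : s,
    (ContinuousLinearMap.toSpanSingleton ℂ (A (ξ i))) ∘L EuclideanSpace.proj i
  let D : EuclideanSpace ℂ s →L[ℂ] EuclideanSpace ℂ s := ∑ i : s,
    ((C * ‖A (ξ i)‖ : ℝ) : ℂ) • (ContinuousLinearMap.toSpanSingleton ℂ
      (EuclideanSpace.single i (1 : ℂ))) ∘L EuclideanSpace.proj i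
  have hL (d : EuclideanSpace ℂ s) : L d = ∑ i : s, d i • A (ξ i) := by simp [L]
  have hDi (d : EuclideanSpace ℂ s) (i : s) : D d i = ((C * ‖A (ξ i)‖ : ℝ) : ℂ) * d i := by
    simp [D, Pi.single_apply]
  have hD (d : EuclideanSpace ℂ s) : ‖D d‖ ^ 2 = C ^ 2 * ∑ i : s, ‖A (ξ i)‖ ^ 2 * ‖d i‖ ^ 2 := by
    rw [EuclideanSpace.norm_sq_eq, Finset.mul_sum]
    refine Finset.sum_congr rfl fun i _ => ?_
    rw [hDi, norm_mul, Complex.norm_real, Real.norm_of_nonneg (by positivity)]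
    ring
  obtain ⟨n, u, μ, hμ⟩ := exists_norm_sq_eq_norm_sq_add_sum L D
  -- Eigenvectors are kept only for positive excess over the diagonal; the other directions can be
  -- dropped from an upper bound.
  let U : Fin n → ι → ℂ := fun k i => if hi : i ∈ s then (if 0 < μ k then u k ⟨i, hi⟩ else 0) else 0
  have hU0 (k : Fin n) (i : s) : U k i = if 0 < μ k then u k i else 0 := by
    simp [U, i.2]
  have hμu (k : Fin n) : μ k = ‖L (u k)‖ ^ 2 - ‖D (u k)‖ ^ 2 := by
    rw [hμ, Finset.sum_eq_single k]
    · simp [inner_self_eq_norm_sq_to_K, u.orthonormal.1]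
    · intro j _ hj
      rw [u.orthonormal.2 hj]
      simp
    · simp
  have hnorm (k : Fin n) : ∑ i : s, ‖u k i‖ ^ 2 = 1 := by
    rw [← EuclideanSpace.norm_sq_eq, u.orthonormal.1, one_pow]
  have hUnorm (k : Fin n) : ∑ i ∈ s, ‖U k i‖ ^ 2 = if 0 < μ k then 1 else 0 := by
    rw [← Finset.sum_coe_sort]
    simp_rw [hU0]
    split_ifs
    · exact hnorm k
    · simp
  refine ⟨n, fun k i => (√(μ k) : ℂ) * star (U k i), fun d => ?_, ?_⟩
  · have h1 := hμ (WithLp.toLp 2 fun i : s => d i)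
    rw [hL, hD] at h1
    simp only [Finset.sum_coe_sort s fun i => d i • A (ξ i),
      Finset.sum_coe_sort s fun i => ‖A (ξ i)‖ ^ 2 * ‖d i‖ ^ 2] at h1
    simp_rw [map_sum, map_smul]
    rw [h1]
    gcongr with k
    have h2 : ∑ i ∈ s, (√(μ k) : ℂ) * star (U k i) * d i =
        √(μ k) * ∑ i : s, star (U k i) * d i := by
      rw [Finset.sum_coe_sort s fun i => star (U k i) * d i, Finset.mul_sum]
      simp_rw [mul_assoc]
    rw [h2, norm_mul, mul_pow, Complex.norm_real, Real.norm_of_nonneg (Real.sqrt_nonneg _)]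
    simp_rw [hU0]
    split_ifs with hk
    · rw [Real.sq_sqrt hk.le, PiLp.inner_apply]
      simp [mul_comm]
    · refine (mul_nonpos_of_nonpos_of_nonneg (not_lt.1 hk) (by positivity)).trans (by positivity)
  -- The quantity to bound is the sum of the positive `μ k`. The factor `C` built into `D` cancels
  -- the diagonal term of `sum_norm_sq_map_le`, leaving `C ^ 4`.
  · have h1 := h.sum_norm_sq_map_le hA hξ s U fun y => by
      have h2 (y : Fin n → ℂ) : ∑ i : s, ‖(∑ p, y p • u p) i‖ ^ 2 = ∑ p, ‖y p‖ ^ 2 := by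
        rw [← EuclideanSpace.norm_sq_eq,
          norm_sq_sum_smul_of_orthogonal _ y u u.orthonormal.2]
        simp
      have h3 := h2 fun p => if 0 < μ p then y p else 0
      have h4 (i : s) : (∑ p, (if 0 < μ p then y p else 0) • u p) i = ∑ p, y p * U p i := by
        rw [WithLp.ofLp_sum, Finset.sum_apply]
        refine Finset.sum_congr rfl fun p _ => ?_
        rw [hU0]
        split_ifs <;> simp
      simp_rw [h4] at h3
      rw [Finset.sum_coe_sort s fun i => ‖∑ p, y p * U p i‖ ^ 2] at h3
      rw [h3]
      gcongr with p
      split_ifs <;> simp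
    have h5 (k : Fin n) : ∑ i ∈ s, ‖(√(μ k) : ℂ) * star (U k i)‖ ^ 2 =
        ‖A (∑ i ∈ s, U k i • ξ i)‖ ^ 2 - C ^ 2 * ∑ i ∈ s, ‖A (ξ i)‖ ^ 2 * ‖U k i‖ ^ 2 := by
      simp_rw [norm_mul, mul_pow, norm_star, Complex.norm_real]
      rw [← Finset.mul_sum, hUnorm]
      simp_rw [map_sum, map_smul]
      rw [← Finset.sum_coe_sort s fun i => U k i • A (ξ i),
        ← Finset.sum_coe_sort s fun i => ‖A (ξ i)‖ ^ 2 * ‖U k i‖ ^ 2]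
      simp_rw [hU0]
      split_ifs with hk
      · rw [← hL, ← hD, ← hμu, Real.norm_of_nonneg (Real.sqrt_nonneg _), Real.sq_sqrt hk.le,
          mul_one]
      · simp
    simp_rw [h5]
    rw [Finset.sum_sub_distrib, ← Finset.mul_sum]
    linarith

open Matrix in
theorem sum_norm_sq_mulVec_le {n : ℕ} (B : Matrix (Fin n) (Fin n) ℂ) {c : ℝ}
    (h : ∀ y : Fin n → ℂ, ∑ q, ‖(y ᵥ* B) q‖ ^ 2 ≤ c ^ 2 * ∑ p, ‖y p‖ ^ 2) (x : Fin n → ℂ) :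
    ∑ p, ‖(B *ᵥ x) p‖ ^ 2 ≤ c ^ 2 * ∑ q, ‖x q‖ ^ 2 := by
  have h1 := (sum_norm_sq_inner_le_iff (fun p q => star (B p q)) c).2 fun y => by
    have h2 := h (star y)
    have h3 (q : Fin n) : ‖(star y ᵥ* B) q‖ = ‖∑ p, y p • star (B p q)‖ := by
      rw [← norm_star]
      simp [Matrix.vecMul, dotProduct, star_sum]
    simpa [h3] using h2
  have h2 := h1 x
  have h3 (p : Fin n) : ∑ q, ⟪star (B p q), x q⟫_ℂ = (B *ᵥ x) p := by
    simp [Matrix.mulVec, dotProduct, mul_comm]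
  simpa only [h3] using h2

-- Cauchy–Schwarz bounds the operator norm of `∑ w_i a_i` by `‖w‖₂` times the row bound, and that
-- norm also governs its action on columns. This lets the row norm absorb a trace class column form.
open Matrix in
theorem sum_norm_sq_sum_mul_mulVec_le {n : ℕ} {s : Finset ι} {a : ι → Matrix (Fin n) (Fin n) ℂ}
    {c : ℝ} (h : ∀ y : Fin n → ℂ, ∑ q, ∑ i ∈ s, ‖(y ᵥ* a i) q‖ ^ 2 ≤ c ^ 2 * ∑ p, ‖y p‖ ^ 2)
    (w : ι → ℂ) (x : Fin n → ℂ) :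
    ∑ p, ‖∑ i ∈ s, w i * (a i *ᵥ x) p‖ ^ 2 ≤
      (∑ i ∈ s, ‖w i‖ ^ 2) * (c ^ 2 * ∑ q, ‖x q‖ ^ 2) := by
  have h1 := sum_norm_sq_mulVec_le (∑ i ∈ s, w i • a i) (c := √(∑ i ∈ s, ‖w i‖ ^ 2) * c)
    (fun y => ?_) x
  · rw [mul_pow, Real.sq_sqrt (by positivity), mul_assoc] at h1
    refine le_of_eq_of_le (Finset.sum_congr rfl fun p _ => ?_) h1
    rw [Matrix.sum_mulVec, Finset.sum_apply]
    simp_rw [Matrix.smul_mulVec, Pi.smul_apply, smul_eq_mul]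
  · rw [mul_pow, Real.sq_sqrt (by positivity), mul_assoc]
    refine le_trans ?_ (mul_le_mul_of_nonneg_left (h y) (by positivity))
    rw [Finset.mul_sum]
    refine Finset.sum_le_sum fun q _ => ?_
    rw [Matrix.vecMul_sum, Finset.sum_apply]
    simp_rw [Matrix.vecMul_smul, Pi.smul_apply, smul_eq_mul]
    refine (pow_le_pow_left₀ (norm_nonneg _) (norm_sum_le _ _) 2).trans ?_
    simp_rw [norm_mul]
    exact Finset.sum_mul_sq_le_sq_mul_sq _ _ _

-- The column part costs `C²` for the diagonal and `C⁴` for the trace class form, the latter paid by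
-- the row bound; `C² + C⁴ ≤ (2 C²)²`.
open Matrix in
theorem IsCompletelyUnconditional.matNorm_le_of_weightedBound (hA : ‖A‖ ≤ 1)
    (hξ : ∀ i, ‖ξ i‖ = 1) (h : IsCompletelyUnconditional C (fun i => toX A (ξ i))) {n : ℕ}
    {s : Finset ι} {a : ι → Matrix (Fin n) (Fin n) ℂ} {c : ℝ} (hc : 0 ≤ c)
    (hw : WeightedBound (fun i => ‖A (ξ i)‖) s a c) :
    matNorm (tensorSum s a (fun i => toX A (ξ i))) ≤ 2 * C ^ 2 * c := by
  have hC : 1 ≤ C ^ 2 := one_le_pow₀ h.1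
  refine (matNorm_tensorSum_toX_le_iff A s a ξ (by positivity)).2 ⟨fun y => ?_, fun x => ?_⟩
  · calc ∑ q, ‖∑ i ∈ s, (y ᵥ* a i) q • ξ i‖ ^ 2
        ≤ ∑ q, C ^ 2 * ∑ i ∈ s, ‖(y ᵥ* a i) q‖ ^ 2 :=
          Finset.sum_le_sum fun q _ => h.norm_sum_sq_le hA hξ s _
      _ = C ^ 2 * ∑ q, ∑ i ∈ s, ‖(y ᵥ* a i) q‖ ^ 2 := by rw [Finset.mul_sum]
      _ ≤ C ^ 2 * (c ^ 2 * ∑ p, ‖y p‖ ^ 2) := by gcongr; exact hw.1 y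
      _ ≤ (4 * C ^ 2 * C ^ 2) * (c ^ 2 * ∑ p, ‖y p‖ ^ 2) := by
          gcongr
          nlinarith
      _ = _ := by ring
  · obtain ⟨N, w, hw1, hw2⟩ := h.exists_norm_sq_map_sum_le hA hξ s
    calc ∑ p, ‖A (∑ i ∈ s, (a i *ᵥ x) p • ξ i)‖ ^ 2
        ≤ ∑ p, (C ^ 2 * ∑ i ∈ s, ‖A (ξ i)‖ ^ 2 * ‖(a i *ᵥ x) p‖ ^ 2 +
            ∑ k, ‖∑ i ∈ s, w k i * (a i *ᵥ x) p‖ ^ 2) :=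
          Finset.sum_le_sum fun p _ => hw1 _
      _ = C ^ 2 * ∑ p, ∑ i ∈ s, ‖A (ξ i)‖ ^ 2 * ‖(a i *ᵥ x) p‖ ^ 2 +
            ∑ k, ∑ p, ‖∑ i ∈ s, w k i * (a i *ᵥ x) p‖ ^ 2 := by
          rw [Finset.sum_add_distrib, ← Finset.mul_sum, Finset.sum_comm (s := Finset.univ)
            (t := (Finset.univ : Finset (Fin N)))]
      _ ≤ C ^ 2 * (c ^ 2 * ∑ q, ‖x q‖ ^ 2) +
            ∑ k, (∑ i ∈ s, ‖w k i‖ ^ 2) * (c ^ 2 * ∑ q, ‖x q‖ ^ 2) := by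
          gcongr with k
          · exact hw.2 x
          · exact sum_norm_sq_sum_mul_mulVec_le hw.1 _ x
      _ = (C ^ 2 + ∑ k, ∑ i ∈ s, ‖w k i‖ ^ 2) * (c ^ 2 * ∑ q, ‖x q‖ ^ 2) := by
          rw [add_mul, Finset.sum_mul]
      _ ≤ (4 * C ^ 4) * (c ^ 2 * ∑ q, ‖x q‖ ^ 2) := by
          gcongr
          nlinarith
      _ = _ := by ring

end Domination

/-! ### Counting weights of completely unconditional families. -/

section Counting

variable {ι : Type*} {ξ : ι → EllTwo} {C : ℝ}

theorem norm_sq_diag_apply_le {α : ℕ → unitInterval} (hα : Antitone α) (M : ℕ) (η : EllTwo) :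
    ‖diag α η‖ ^ 2 ≤
      ∑ j ∈ Finset.range M, (α j : ℝ) ^ 2 * ‖η j‖ ^ 2 + (α M : ℝ) ^ 2 * ‖η‖ ^ 2 := by
  have hs (f : EllTwo) : HasSum (fun j => ‖f j‖ ^ 2) (‖f‖ ^ 2) := by
    have := lp.hasSum_norm (p := 2) (by norm_num) f
    simpa using this
  have h1 := hasSum_sum_of_ne_finset_zero (L := SummationFilter.unconditional ℕ) (s := Finset.range M)
    (f := fun j => if j < M then (α j : ℝ) ^ 2 * ‖η j‖ ^ 2 else 0)
    fun j hj => if_neg (by simpa using hj)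
  have h2 : ∑ j ∈ Finset.range M, (if j < M then (α j : ℝ) ^ 2 * ‖η j‖ ^ 2 else 0) =
      ∑ j ∈ Finset.range M, (α j : ℝ) ^ 2 * ‖η j‖ ^ 2 :=
    Finset.sum_congr rfl fun j hj => if_pos (Finset.mem_range.1 hj)
  rw [h2] at h1
  refine hasSum_le (fun j => ?_) (hs (diag α η)) (h1.add ((hs η).mul_left _))
  rw [diag_apply, norm_mul, mul_pow, Complex.norm_real, Real.norm_of_nonneg (α j).2.1]
  split_ifs with hj
  · exact le_add_of_nonneg_right (by positivity)
  · rw [zero_add]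
    gcongr
    · exact (α j).2.1
    · exact hα (not_lt.1 hj)

/-- With `d_i` the conjugate of the `j`-th coordinate of `ξ_i`, the `j`-th coordinate of the
combination is the sum `S` itself, so `S² ≤ C² S`. -/
theorem sum_norm_sq_coord_le {s : Finset ι}
    (h : ∀ d : ι → ℂ, ‖∑ i ∈ s, d i • ξ i‖ ^ 2 ≤ C ^ 2 * ∑ i ∈ s, ‖d i‖ ^ 2) (j : ℕ) :
    ∑ i ∈ s, ‖ξ i j‖ ^ 2 ≤ C ^ 2 := by
  set S := ∑ i ∈ s, ‖ξ i j‖ ^ 2 with hS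
  have hS0 : 0 ≤ S := by positivity
  have h1 := h fun i => star (ξ i j)
  simp_rw [norm_star] at h1
  rw [← hS] at h1
  have h2 : (∑ i ∈ s, star (ξ i j) • ξ i) j = (S : ℂ) := by
    rw [lp.coeFn_sum, Finset.sum_apply, hS]
    push_cast
    refine Finset.sum_congr rfl fun i _ => ?_
    rw [lp.coeFn_smul, Pi.smul_apply, smul_eq_mul]
    exact Complex.conj_mul' _
  have h3 := lp.norm_apply_le_norm two_ne_zero (∑ i ∈ s, star (ξ i j) • ξ i) j
  rw [h2, Complex.norm_real, Real.norm_of_nonneg hS0] at h3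
  have h4 : S ^ 2 ≤ C ^ 2 * S := (pow_le_pow_left₀ hS0 h3 2).trans h1
  rcases hS0.eq_or_lt with h0 | h0
  · rw [← h0]
    positivity
  · exact le_of_mul_le_mul_right (by linarith) h0

/-- A Hilbert–Schmidt estimate that replaces the dimension argument, because the `ξ_i` need not be
orthogonal here. -/
theorem IsCompletelyUnconditional.sum_norm_sq_diag_le {α : ℕ → unitInterval} (hα : Antitone α)
    (hξ : ∀ i, ‖ξ i‖ = 1) (h : IsCompletelyUnconditional C (fun i => toX (diag α) (ξ i)))
    (M : ℕ) (F : Finset ι) :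
    ∑ i ∈ F, ‖diag α (ξ i)‖ ^ 2 ≤
      C ^ 2 * ∑ j ∈ Finset.range M, (α j : ℝ) ^ 2 + F.card * (α M : ℝ) ^ 2 := by
  calc ∑ i ∈ F, ‖diag α (ξ i)‖ ^ 2
      ≤ ∑ i ∈ F, (∑ j ∈ Finset.range M, (α j : ℝ) ^ 2 * ‖ξ i j‖ ^ 2 + (α M : ℝ) ^ 2) :=
        Finset.sum_le_sum fun i _ => by simpa [hξ] using norm_sq_diag_apply_le hα M (ξ i)
    _ = ∑ j ∈ Finset.range M, (α j : ℝ) ^ 2 * ∑ i ∈ F, ‖ξ i j‖ ^ 2 +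
          F.card * (α M : ℝ) ^ 2 := by
        rw [Finset.sum_add_distrib, Finset.sum_comm, Finset.sum_const, nsmul_eq_mul]
        simp_rw [Finset.mul_sum]
    _ ≤ ∑ j ∈ Finset.range M, (α j : ℝ) ^ 2 * C ^ 2 + F.card * (α M : ℝ) ^ 2 := by
        gcongr with j
        exact sum_norm_sq_coord_le (fun d => h.norm_sum_sq_le (norm_diag_le_one α) hξ F d) j
    _ = _ := by rw [← Finset.sum_mul, mul_comm]

variable {r : unitInterval} {b : ℕ}

theorem blockSeq_le_pow (hb : 2 ≤ b) {K j : ℕ} (hj : b ^ K ≤ j) :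
    (blockSeq r b j : ℝ) ≤ (r : ℝ) ^ K :=
  pow_le_pow_of_le_one r.2.1 r.2.2 (Nat.le_log_of_pow_le hb (by omega))

/-- Each block contributes at most the bound already reached, and `b * r² ≥ 2` absorbs the doubling.
-/
theorem sum_sq_blockSeq_le (hb : 2 ≤ b) (hbr : 2 ≤ b * (r : ℝ) ^ 2) (K : ℕ) :
    ∑ j ∈ Finset.range (b ^ K), (blockSeq r b j : ℝ) ^ 2 ≤ b * (b * (r : ℝ) ^ 2) ^ K := by
  induction K with
  | zero =>
    have : (1 : ℝ) ≤ b := by exact_mod_cast (by omega : 1 ≤ b)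
    simpa [coe_blockSeq] using this
  | succ K ih =>
    have h1 : b ^ K ≤ b ^ (K + 1) := Nat.pow_le_pow_right (by omega) (by omega)
    rw [← Finset.sum_range_add_sum_Ico _ h1]
    have h2 : ∑ j ∈ Finset.Ico (b ^ K) (b ^ (K + 1)), (blockSeq r b j : ℝ) ^ 2 ≤
        b ^ (K + 1) * ((r : ℝ) ^ K) ^ 2 := by
      refine (Finset.sum_le_card_nsmul _ _ (((r : ℝ) ^ K) ^ 2) fun j hj => ?_).trans ?_
      · exact pow_le_pow_left₀ (blockSeq r b j).2.1 (blockSeq_le_pow hb (Finset.mem_Ico.1 hj).1) 2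
      · rw [Nat.card_Ico, nsmul_eq_mul]
        gcongr
        exact_mod_cast Nat.sub_le _ _
    calc _ ≤ b * (b * (r : ℝ) ^ 2) ^ K + b ^ (K + 1) * ((r : ℝ) ^ K) ^ 2 := add_le_add ih h2
      _ = (b * (b * (r : ℝ) ^ 2) ^ K) * 2 := by ring
      _ ≤ (b * (b * (r : ℝ) ^ 2) ^ K) * (b * (r : ℝ) ^ 2) := by gcongr
      _ = _ := by ring

theorem IsCompletelyUnconditional.card_le_of_blockSeq (hr0 : 0 < (r : ℝ)) (hr : (r : ℝ) < 1)
    (hb : 2 ≤ b) (hbr : 2 ≤ b * (r : ℝ) ^ 2) (hξ : ∀ i, ‖ξ i‖ = 1)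
    (h : IsCompletelyUnconditional C (fun i => toX (diag (blockSeq r b)) (ξ i))) (k : ℕ)
    (F : Finset ι) (hF : ∀ i ∈ F, (r : ℝ) ^ (k + 1) < ‖diag (blockSeq r b) (ξ i)‖) :
    (F.card : ℝ) ≤ C ^ 2 * (b ^ 2 / (1 - (r : ℝ) ^ 2)) * b ^ (k + 1) := by
  have hr2 : 0 < 1 - (r : ℝ) ^ 2 := sub_pos.2 (pow_lt_one₀ hr0.le hr two_ne_zero)
  -- Cutting at `b ^ (k + 2)` makes the tail value at most `r ^ (k + 2)`, smaller than the threshold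
  -- by a factor `r`; the tail term is then absorbed on the left, leaving `1 - r²`.
  have h1 := h.sum_norm_sq_diag_le (blockSeq_mem_SeqS hr hb).1 hξ (b ^ (k + 2)) F
  have h2 : F.card * ((r : ℝ) ^ (k + 1)) ^ 2 ≤ ∑ i ∈ F, ‖diag (blockSeq r b) (ξ i)‖ ^ 2 := by
    rw [← nsmul_eq_mul]
    exact Finset.card_nsmul_le_sum _ _ _ fun i hi =>
      pow_le_pow_left₀ (by positivity) (hF i hi).le 2
  have h3 : (blockSeq r b (b ^ (k + 2)) : ℝ) ^ 2 ≤ ((r : ℝ) ^ (k + 2)) ^ 2 :=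
    pow_le_pow_left₀ (blockSeq r b _).2.1 (blockSeq_le_pow hb le_rfl) 2
  have h4 : F.card * ((r : ℝ) ^ (k + 1)) ^ 2 ≤
      C ^ 2 * (b * (b * (r : ℝ) ^ 2) ^ (k + 2)) + F.card * ((r : ℝ) ^ (k + 2)) ^ 2 := by
    refine h2.trans (h1.trans ?_)
    gcongr
    exact sum_sq_blockSeq_le hb hbr _
  have h5 : (F.card * (1 - (r : ℝ) ^ 2)) * ((r : ℝ) ^ (k + 1)) ^ 2 ≤
      (C ^ 2 * b ^ 2 * b ^ (k + 1) * (r : ℝ) ^ 2) * ((r : ℝ) ^ (k + 1)) ^ 2 := by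
    have e1 : C ^ 2 * (b * (b * (r : ℝ) ^ 2) ^ (k + 2)) =
      (C ^ 2 * b ^ 2 * b ^ (k + 1) * (r : ℝ) ^ 2) * ((r : ℝ) ^ (k + 1)) ^ 2 := by ring
    have e2 : (F.card : ℝ) * ((r : ℝ) ^ (k + 2)) ^ 2 =
      F.card * (r : ℝ) ^ 2 * ((r : ℝ) ^ (k + 1)) ^ 2 := by ring
    rw [e1, e2] at h4
    linarith
  have h6 := le_of_mul_le_mul_right h5 (by positivity)
  have h7 : C ^ 2 * b ^ 2 * b ^ (k + 1) * (r : ℝ) ^ 2 ≤ C ^ 2 * b ^ 2 * b ^ (k + 1) :=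
    mul_le_of_le_one_right (by positivity) (by linarith)
  rw [show C ^ 2 * (b ^ 2 / (1 - (r : ℝ) ^ 2)) * b ^ (k + 1) =
    (C ^ 2 * b ^ 2 * b ^ (k + 1)) / (1 - (r : ℝ) ^ 2) by ring, le_div_iff₀ hr2]
  exact h6.trans h7

theorem IsCompletelyUnconditional.exists_areEquivalent_blockSeq (hr0 : 0 < (r : ℝ))
    (hr : (r : ℝ) < 1) (hb : 2 ≤ b) (hbr : 2 ≤ b * (r : ℝ) ^ 2) (hξ : ∀ i, ‖ξ i‖ = 1)
    (h : IsCompletelyUnconditional C (fun i => toX (diag (blockSeq r b)) (ξ i))) :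
    ∃ π : ι ↪ ℕ, AreEquivalent
      ((2 * (r : ℝ)⁻¹ * (b * (b ^ 2 / (1 - (r : ℝ) ^ 2) + 1))) * C ^ 4)
      (fun i => toX (diag (blockSeq r b)) (ξ i)) (fun i => canonicalBasis (blockSeq r b) (π i)) := by
  have hC : 1 ≤ C := h.1
  have hC0 : 0 ≤ C := zero_le_one.trans hC
  have hr2 : 0 < 1 - (r : ℝ) ^ 2 := sub_pos.2 (pow_lt_one₀ hr0.le hr two_ne_zero)
  have hb1 : (1 : ℝ) < b := by exact_mod_cast (by omega : 1 < b)
  have hA := norm_diag_le_one (blockSeq r b)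
  set D : ℝ := b ^ 2 / (1 - (r : ℝ) ^ 2) with hD
  have hD0 : 0 < D := by positivity
  have hx : 1 ≤ C ^ 2 * (D + 1) :=
    one_le_mul_of_one_le_of_one_le (one_le_pow₀ hC) (by linarith)
  obtain ⟨m, hm1, hm2⟩ := exists_nat_pow_near hx hb1
  obtain ⟨π, hπ⟩ := exists_embedding_blockSeq (t := fun i => ‖diag (blockSeq r b) (ξ i)‖)
    hr0 hr hb (m + 1)
    (fun i => norm_pos_iff.2 fun h0 => by
      have := diag_injective (blockSeq_pos hr0) (h0.trans (map_zero _).symm)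
      simpa [this] using hξ i)
    (fun i => ((diag _).le_of_opNorm_le hA _).trans (by simp [hξ]))
    (fun k F hF => by
      have h1 := h.card_le_of_blockSeq hr0 hr hb hbr hξ k F hF
      have h2 : (F.card : ℝ) ≤ b ^ (k + 1 + (m + 1)) := by
        refine h1.trans ?_
        rw [pow_add (b : ℝ) (k + 1), mul_comm]
        gcongr
        refine le_trans ?_ hm2.le
        gcongr
        linarith
      exact_mod_cast h2)
  set μ : ℝ := (r : ℝ)⁻¹ ^ (m + 1 + 1) with hμ
  have hrinv : 1 ≤ (r : ℝ)⁻¹ := (one_le_inv₀ hr0).2 hr.le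
  have hμ1 : 1 ≤ μ := one_le_pow₀ hrinv
  -- As `r⁻² ≤ b` and `b ^ m ≤ C² (D + 1)`, the loss from the shift by `m + 1` blocks is only linear
  -- in `C`.
  have hμ2 : μ ≤ (r : ℝ)⁻¹ * (b * (D + 1)) * C := by
    have h1 : ((r : ℝ)⁻¹) ^ 2 ≤ b := by
      rw [inv_pow, inv_le_iff_one_le_mul₀ (by positivity)]
      linarith
    have h2 : ((r : ℝ)⁻¹ ^ (m + 1)) ^ 2 ≤ (b * (D + 1) * C) ^ 2 :=
      calc ((r : ℝ)⁻¹ ^ (m + 1)) ^ 2 = (((r : ℝ)⁻¹) ^ 2) ^ (m + 1) := by ring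
        _ ≤ (b : ℝ) ^ (m + 1) := by gcongr
        _ = b * (b : ℝ) ^ m := by ring
        _ ≤ b * (C ^ 2 * (D + 1)) := by gcongr
        _ = (b * (D + 1)) * C ^ 2 := by ring
        _ ≤ (b * (D + 1)) ^ 2 * C ^ 2 := by
            gcongr
            refine le_self_pow₀ ?_ two_ne_zero
            exact one_le_mul_of_one_le_of_one_le hb1.le (by linarith)
        _ = _ := by ring
    have h3 := (sq_le_sq₀ (by positivity) (by positivity)).1 h2
    calc μ = (r : ℝ)⁻¹ * (r : ℝ)⁻¹ ^ (m + 1) := by rw [hμ]; ring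
      _ ≤ (r : ℝ)⁻¹ * (b * (D + 1) * C) := by gcongr
      _ = _ := by ring
  have hdiag := isDiagonalFamily_stdBasis (blockSeq r b) π
  refine ⟨π, areEquivalent_of_matNorm_le (c₁ := C) (c₂ := 2 * C ^ 2 * μ) hC0 (by positivity) ?_
    (fun n s a => ?_) fun n s a => ?_⟩
  -- The exponent four: `C` from sign averaging, `C²` from the domination of the column form, and
  -- `C` from `μ`.
  · calc C * (2 * C ^ 2 * μ) ≤ C * (2 * C ^ 2 * ((r : ℝ)⁻¹ * (b * (D + 1)) * C)) := by gcongr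
      _ = _ := by ring
  · refine (hdiag.matNorm_le_iff s a (mul_nonneg hC0 (matNorm_nonneg _))).2 ?_
    have h1 := (h.weightedBound hξ s a).mono_weight (t' := fun i => (blockSeq r b (π i) : ℝ))
      le_rfl (fun i => (blockSeq r b (π i)).2.1) fun i => by simpa using (hπ i).1
    simpa using h1
  · have h1 := ((hdiag.matNorm_le_iff s a (matNorm_nonneg _)).1 le_rfl).mono_weight
      (t' := fun i => ‖diag (blockSeq r b) (ξ i)‖) hμ1 (fun i => norm_nonneg _) fun i => (hπ i).2
    have h2 := h.matNorm_le_of_weightedBound hA hξ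
      (mul_nonneg (by positivity) (matNorm_nonneg _)) h1
    rwa [← mul_assoc] at h2

end Counting

end OpSpace

/-! ### The theorem, with `r = 1/a` and `b ≥ 2a²`. -/

theorem mainTheorem5 (a : ℝ) (ha : 1 < a) :
    ∃ α ∈ SeqS, (¬ Summable fun i => (α i : ℝ) ^ 2) ∧
      (∀ Y : Submodule ℂ (EllTwoSum →L[ℂ] EllTwoSum),
        IsClosed (Y : Set (EllTwoSum →L[ℂ] EllTwoSum)) → Y ≤ XdSpace α →
        (∃ (ι : Type) (_ : Countable ι) (s : ι → ℝ) (f : ι → (EllTwoSum →L[ℂ] EllTwoSum)),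
          IsCanonicalBasis (diag α) Y s f) ∧
        (∀ (ι : Type) (s : ι → ℝ) (f : ι → (EllTwoSum →L[ℂ] EllTwoSum)),
          IsCanonicalBasis (diag α) Y s f →
            IsCompletelyUnconditionalBasis 1 Y f ∧
            ∃ π : ι ↪ ℕ, AreEquivalent a f (fun i => canonicalBasis α (π i))) ∧
        (∀ (ι : Type) [LinearOrder ι] (s : ι → ℝ) (f : ι → (EllTwoSum →L[ℂ] EllTwoSum)),
          IsCanonicalBasis (diag α) Y s f → Antitone s →
            ∃ π : ι ↪o ℕ, AreEquivalent a f (fun i => canonicalBasis α (π i)))) ∧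
      (∃ (K : ℝ) (B : ℕ), 0 < K ∧ 0 < B ∧
        ∀ (C : ℝ) (ι : Type) [Countable ι] (g : ι → (EllTwoSum →L[ℂ] EllTwoSum)),
          (∀ i, g i ∈ XdSpace α) → (∀ i, ‖g i‖ = 1) → IsCompletelyUnconditional C g →
            ∃ π : ι ↪ ℕ, AreEquivalent (K * C ^ B) g (fun i => canonicalBasis α (π i))) := by
  obtain ⟨b, hb⟩ := exists_nat_ge (2 * a ^ 2)
  have ha0 : 0 < a := zero_lt_one.trans ha
  let r : unitInterval := ⟨a⁻¹, (inv_pos.2 ha0).le, inv_le_one_of_one_le₀ ha.le⟩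
  have hr0 : 0 < (r : ℝ) := inv_pos.2 ha0
  have hr1 : (r : ℝ) < 1 := inv_lt_one_of_one_lt₀ ha
  have hra : (r : ℝ)⁻¹ = a := inv_inv a
  have hb2 : 2 ≤ b := by
    have : (2 : ℝ) ≤ b := le_trans (by nlinarith) hb
    exact_mod_cast this
  have hbr : 2 ≤ b * (r : ℝ) ^ 2 := by
    change 2 ≤ b * (a⁻¹) ^ 2
    rwa [inv_pow, ← div_eq_mul_inv, le_div_iff₀ (by positivity)]
  have hr2 : 0 < 1 - (r : ℝ) ^ 2 := sub_pos.2 (pow_lt_one₀ hr0.le hr1 two_ne_zero)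
  refine ⟨blockSeq r b, blockSeq_mem_SeqS hr1 hb2,
    not_summable_sq_blockSeq (by linarith) hb2, fun Y hY hYX => ⟨?_, ?_, ?_⟩,
    2 * (r : ℝ)⁻¹ * (b * (b ^ 2 / (1 - (r : ℝ) ^ 2) + 1)), 4, by positivity, by norm_num, ?_⟩
  · exact exists_isCanonicalBasis hr0 hr1 hb2 hY
  · rintro ι s f ⟨_, ξ, hξ, hf⟩
    obtain rfl : f = fun i => toX (diag (blockSeq r b)) (ξ i) := funext hf
    obtain ⟨π, hπ⟩ := hξ.isDiagonalFamily.exists_embedding hr0 hr1 hb2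
    exact ⟨⟨hξ.isDiagonalFamily.isCompletelyUnconditional, hξ.closedSpan_eq hY hYX⟩,
      π, hra ▸ hπ⟩
  · rintro ι _ s f ⟨_, ξ, hξ, hf⟩ hs
    obtain rfl : f = fun i => toX (diag (blockSeq r b)) (ξ i) := funext hf
    obtain ⟨π, hπ⟩ := hξ.isDiagonalFamily.exists_orderEmbedding hr0 hr1 hb2 hs
    exact ⟨π, hra ▸ hπ⟩
  · intro C ι _ g hgX hg hC
    choose ξ hξ using hgX
    obtain rfl : g = fun i => toX (diag (blockSeq r b)) (ξ i) := funext fun i => (hξ i).symm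
    exact hC.exists_areEquivalent_blockSeq hr0 hr1 hb2 hbr fun i =>
      (norm_toX (norm_diag_le_one _) (ξ i)).symm.trans (hg i)
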